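/- **Setting.** Let $\mathcal{G}^{\mathcal{L}}=(\mathbf{V},\mathbf{E},\mathcal{L})$ be a labeled DAG on a finite set $\mathbf V$ of variables. A label $\ell\in\mathcal{L}_{(V_i,V_j)}$ of an edge $(V_i,V_j)$ is a realization of a set of parents of $V_j$ other than $V_i$. The context variables $\mathbf{C}(\mathcal{L})$ are the variables that occur in some label; their domains are countable and discrete, the other domains are arbitrary measurable spaces. A compatible model $M\in\mathcal{M}_{\langle\mathcal{G}^{\mathcal{L}}\rangle}$ is a structural causal model $V\leftarrow f_V(\mathbf{Pa}(V),U_V)$ with mutually independent exogenous $U_V$, such that for every $\ell\in\mathcal{L}_{(V_i,V_j)}$ the law of $f_{V_j}(\mathbf{pa},U_{V_j})$ does not depend on the coordinate $V_i$ of $\mathbf{pa}$ as long as $\mathbf{pa}$ agrees with $\ell$. Let $\mathbf{O}\subseteq\mathbf{V}$ be the observed variables, $X\in\mathbf{O}$ the action, $Y\in\mathbf V\setminus\mathbf{O}$ the reward, and $\mathbf{Pa}^\Pi\subseteq\mathbf{O}\setminus\mathbf{De}(X)$. A policy is a Markov kernel $\pi(X\mid\mathbf{Pa}^\Pi)$,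 $\Pi$ is the set of policies, and $do(\pi)$ replaces $f_X$ by $\pi$. Let $P(\mathbf{O})$ be given. For a realization $\mathbf c$ of a set $\mathbf{C}$ of variables, the edge $(V_i,V_j)$ is absent in context $\mathbf{c}$ if every full assignment extending $\mathbf{c}$ satisfies some label of the edge. $\mathcal{G}^{\mathcal{L}}(\mathbf{c})$ is the DAG obtained by deleting the edges absent in context $\mathbf{c}$; $\mathcal{G}^{\mathcal{L}}(\mathbf{c})_{\underline X}$ is obtained from it by deleting the edges out of $X$, and $\mathcal{G}^{\mathcal{L}}(\mathbf{c})\cup\Pi$ by adding all edges from $\mathbf{Pa}^\Pi$ to $X$. **Algorithm.** Imitate2 returns what SubImitate returns for $\mathbf{C}=\emptyset$. SubImitate, for $\mathbf{C}=\mathbf{c}$, does the following. 1. *FindSep.* Let $\mathbf{Z}_{\mathbf c}=\mathbf{An}(\{X,Y\}\cup\mathbf{C})\cap\mathbf{Pa}^\Pi$, ancestors (including the vertices themselves) being taken in $\mathcal{G}^{\mathcal{L}}(\mathbf{c})$. If $\mathbf{Z}_{\mathbf c}$ d-separates $X$ and $Y$ in $\mathcal{G}^{\mathcal{L}}(\mathbf{c})_{\underline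 X}$, return a policy $\pi_{\mathbf c}(X\mid\mathbf{Pa}^\Pi)=P(X\mid\mathbf{Z}_{\mathbf c},\mathbf{C}=\mathbf{c})$ (any version of this conditional distribution). 2. Otherwise, if there are sets $\mathbf{T}$ with $\mathbf{C}\subseteq\mathbf{T}\subseteq\mathbf{O}\setminus\{X\}$ that d-separate $X$ and $Y$ in $\mathcal{G}^{\mathcal{L}}(\mathbf{c})\cup\Pi$, take a minimal one and put $\mathbf{S}_{\mathbf c}=\mathbf{T}\setminus\mathbf{C}$ (*FindMinSep*). If an identification subroutine (*Csi-Id*) identifies the effect $P(\mathbf{S}_{\mathbf c}\mid do(\pi_{\mathbf c}),\mathbf{C}=\mathbf{c})$ from $P(\mathbf{O})$ — an answer $q$ of this subroutine is the value of this effect in every compatible model inducing $P(\mathbf{O})$, but the subroutine may fail on any query — and the policy $\pi_{\mathbf c}\in\Pi$ solves $P(\mathbf{S}_{\mathbf c}\mid do(\pi_{\mathbf c}),\mathbf{c})=P(\mathbf{S}_{\mathbf c}\mid\mathbf{c})$, return such a $\pi_{\mathbf c}$. 3. If no policy has been returned, choose an arbitrary $W\in(\mathbf{C}(\mathcal{L})\cap\mathbf{Pa}^\Pi)\setminus\mathbf{C}$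 (fail if there is none), call SubImitate with $\mathbf{C}\cup\{W\}$ and $\mathbf{c}\cup\{w\}$ for every $w\in\mathcal{D}_W$ (fail if one of these calls fails), and return $\pi_{\mathbf c}(X\mid\mathbf{Pa}^\Pi)=\sum_{w\in\mathcal D_W}\mathbb{1}\{(\mathbf{Pa}^\Pi)_W=w\}\,\pi_{\mathbf{c},w}(X\mid\mathbf{Pa}^\Pi)$. **Theorem (soundness).** If some run of Imitate2 on $\mathcal{G}^{\mathcal{L}},\Pi,X,Y,P(\mathbf{O})$ returns $\pi^*$, then $\pi^*$ is an optimal imitating policy for $P(y)$ w.r.t. $\langle\mathcal{G}^{\mathcal{L}},\Pi,P(\mathbf{O})\rangle$: $\pi^*\in\Pi$, and for every $M\in\mathcal{M}_{\langle\mathcal{G}^{\mathcal{L}}\rangle}$ with $P^M(\mathbf{O})=P(\mathbf{O})$ one has $P^M(y\mid do(\pi^*))=P^M(y)$. -/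

import Mathlib

open MeasureTheory ProbabilityTheory

universe uV uD uU

/-- A partial assignment of values to the variables: the realization `c` of the set of variables
`{v | c v ≠ none}`.  Both labels and contexts are partial assignments. -/
def PartialAssignment {V : Type uV} (D : V → Type uD) : Type (max uV uD) :=
  ∀ v, Option (D v)

namespace PartialAssignment

variable {V : Type uV} {D : V → Type uD}

/-- The set of variables that are assigned a value. -/
def dom (c : PartialAssignment D) : Set V := {v | c v ≠ none}

/-- The full assignment `w` extends `c`, i.e. `(w)_C = c`. -/
def Agrees (c : PartialAssignment D) (w : ∀ v, D v) : Prop :=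
  ∀ v a, c v = some a → w v = a

/-- The assignment `w` of the variables in `T` is consistent with `c`. -/
def AgreesOn (c : PartialAssignment D) {T : Set V} (w : ∀ v : T, D v) : Prop :=
  ∀ (v : T) (a : D v), c v = some a → w v = a

/-- The realization of the empty set of variables. -/
def empty : PartialAssignment D := fun _ => none

end PartialAssignment

namespace DiGraph

variable {V : Type uV}

/-- A path from `x` to `y` in the directed graph with edge relation `E`: a nonintersecting sequence
of vertices, consecutive ones joined by an edge of either orientation. -/
def IsPath (E : V → V → Prop) (x y : V) (p : List V) : Prop :=
  p.head? = some x ∧ p.getLast? = some y ∧ p.Nodup ∧ p.IsChain (fun a b => E a b ∨ E b a)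

/-- The path `p` is blocked by `Z`: it has a non-collider in `Z`, or a collider none of whose
descendants (itself included) is in `Z`. -/
def Blocked (E : V → V → Prop) (Z : Set V) (p : List V) : Prop :=
  ∃ a m b, [a, m, b] <:+: p ∧
    ((¬ (E a m ∧ E b m) ∧ m ∈ Z) ∨
      ((E a m ∧ E b m) ∧ ∀ d, Relation.ReflTransGen E m d → d ∉ Z))

/-- `Z` d-separates `x` and `y`. -/
def DSep (E : V → V → Prop) (x y : V) (Z : Set V) : Prop :=
  ∀ p, IsPath E x y p → Blocked E Z p

/-- The graph without the edges that leave `x`. -/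
def removeOut (E : V → V → Prop) (x : V) : V → V → Prop := fun a b => E a b ∧ a ≠ x

/-- The graph with all edges from `P` to `x` added. -/
def addParents (E : V → V → Prop) (P : Set V) (x : V) : V → V → Prop :=
  fun a b => E a b ∨ (a ∈ P ∧ b = x)

end DiGraph

/-- A labeled DAG on the variables `V` with domains `D`.  A label of the edge `(i, j)` is a
realization of some of the parents of `j` other than `i`. -/
structure LDAG (V : Type uV) (D : V → Type uD) where
  edge : V → V → Prop
  acyclic : ∀ v, ¬ Relation.TransGen edge v v
  label : V → V → Set (PartialAssignment D)
  label_edge : ∀ i j ℓ, ℓ ∈ label i j → edge i j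
  label_dom : ∀ i j ℓ, ℓ ∈ label i j → ∀ v ∈ ℓ.dom, edge v j ∧ v ≠ i

namespace LDAG

variable {V : Type uV} {D : V → Type uD}

/-- The parents of `v`. -/
def Pa (G : LDAG V D) (v : V) : Set V := {w | G.edge w v}

/-- The context variables: those that occur in some label. -/
def contextVars (G : LDAG V D) : Set V := {v | ∃ i j, ∃ ℓ ∈ G.label i j, v ∈ ℓ.dom}

/-- The edge `(i, j)` is absent in the context `c`: however `c` is completed, one of the labels of
the edge is satisfied. -/
def AbsentIn (G : LDAG V D) (c : PartialAssignment D) (i j : V) : Prop :=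
  ∀ w : ∀ v, D v, c.Agrees w → ∃ ℓ ∈ G.label i j, ℓ.Agrees w

/-- The edges of the context-specific DAG: those of `G` that are not absent in the context `c`. -/
def contextDAG (G : LDAG V D) (c : PartialAssignment D) : V → V → Prop :=
  fun i j => G.edge i j ∧ ¬ G.AbsentIn c i j

theorem wellFounded_edge [Finite V] (G : LDAG V D) : WellFounded G.edge := by
  have : IsTrans V (Relation.TransGen G.edge) := ⟨fun _ _ _ => Relation.TransGen.trans⟩
  have : Std.Irrefl (Relation.TransGen G.edge) := ⟨G.acyclic⟩
  exact Subrelation.wf (fun h => Relation.TransGen.single h)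
    (Finite.wellFounded_of_trans_of_irrefl (Relation.TransGen G.edge))

/-- The unique solution of a system of equations `v = g v (Pa v)`. -/
noncomputable def solve [Finite V] (G : LDAG V D) (g : ∀ v, (∀ w : G.Pa v, D w) → D v) :
    ∀ v, D v :=
  G.wellFounded_edge.fix (fun v ih => g v (fun w => ih w.1 w.2))

theorem solve_eq [Finite V] (G : LDAG V D) (g : ∀ v, (∀ w : G.Pa v, D w) → D v) (v : V) :
    G.solve g v = g v (fun w => G.solve g w) :=
  G.wellFounded_edge.fix_eq _ v

end LDAG

/-- A structural causal model compatible with the LDAG `G`.  Every variable `v` is a function `f v`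
of its parents in `G` and of its own exogenous noise with law `noise v`; the noises are
independent (all common causes are vertices of the graph).  A label `ℓ` of the edge `(i, j)` means
that the mechanism of `j` ignores `i` in the context `ℓ`: as long as the parents of `j` agree with
`ℓ`, the conditional law of `j` given its parents does not depend on the value of `i`. -/
structure SCM {V : Type uV} {D : V → Type uD} [∀ v, MeasurableSpace (D v)] (G : LDAG V D) where
  U : V → Type uU
  [measU : ∀ v, MeasurableSpace (U v)]
  noise : ∀ v, Measure (U v)
  [probU : ∀ v, IsProbabilityMeasure (noise v)]
  f : ∀ v, (∀ w : G.Pa v, D w) → U v → D v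
  measurable_f : ∀ v, Measurable (fun q : (∀ w : G.Pa v, D w) × U v => f v q.1 q.2)
  local_csi : ∀ i j, ∀ ℓ ∈ G.label i j, ∀ p p' : ∀ w : G.Pa j, D w, ℓ.AgreesOn p →
    (∀ w : G.Pa j, w.1 ≠ i → p w = p' w) → (noise j).map (f j p) = (noise j).map (f j p')

namespace SCM

variable {V : Type uV} {D : V → Type uD} [∀ v, MeasurableSpace (D v)] {G : LDAG V D}

attribute [instance] SCM.measU SCM.probU

/-- The values of all variables as a function of the noise. -/
noncomputable def sol [Finite V] (M : SCM.{uV, uD, uU} G) (u : ∀ v, M.U v) : ∀ v, D v :=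
  G.solve (fun v p => M.f v p (u v))

/-- The values of all variables under the intervention `do(X = x)`. -/
noncomputable def solDo [Finite V] [DecidableEq V] (M : SCM.{uV, uD, uU} G) (X : V) (x : D X)
    (u : ∀ v, M.U v) : ∀ v, D v :=
  G.solve (Function.update (fun v p => M.f v p (u v)) X (fun _ => x))

/-- The law `P^M(V)` of all variables. -/
noncomputable def law [Fintype V] (M : SCM.{uV, uD, uU} G) : Measure (∀ v, D v) :=
  (Measure.pi M.noise).map M.sol

/-- The observational distribution `P^M(O)`. -/
noncomputable def obs [Fintype V] (M : SCM.{uV, uD, uU} G) (O : Set V) :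
    Measure (∀ v : O, D v) :=
  M.law.map O.domRestrict

/-- The law `P^M(V | do(π))`: the function of `X` is replaced by a draw from `π` at the values of
the variables in `P`.  It is used for sets `P` of non-descendants of `X`, whose values do not
depend on the value of `X`. -/
noncomputable def lawDo [Fintype V] [DecidableEq V] (M : SCM.{uV, uD, uU} G) (X : V) (P : Set V)
    (π : Kernel (∀ v : P, D v) (D X)) : Measure (∀ v, D v) :=
  (Measure.pi M.noise).bind
    (fun u => (π (P.domRestrict (M.sol u))).map (fun x => M.solDo X x u))

end SCM

/-- The data of an imitation problem: an LDAG, the observable variables `O` (the others are latent),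
the action `X`, the latent reward `Y`, and the inputs `P` of the policies, which are observable
non-descendants of the action. -/
structure ImitationProblem (V : Type uV) (D : V → Type uD) where
  G : LDAG V D
  O : Set V
  X : V
  Y : V
  P : Set V
  X_mem : X ∈ O
  Y_latent : Y ∉ O
  P_subset : P ⊆ O
  P_nondesc : ∀ v ∈ P, ¬ Relation.ReflTransGen G.edge X v

namespace ImitationProblem

variable {V : Type uV} {D : V → Type uD}

/-- The set that the subroutine `FindSep` tests in the context `c`: the ancestors, in the
context-specific DAG, of `X`, `Y` and the context variables that lie in `P`. -/
def sepSet (I : ImitationProblem V D) (c : PartialAssignment D) : Set V :=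
  {v | v ∈ I.P ∧ ∃ t, (t = I.X ∨ t = I.Y ∨ t ∈ c.dom) ∧
    Relation.ReflTransGen (I.G.contextDAG c) v t}

theorem sepSet_subset (I : ImitationProblem V D) (c : PartialAssignment D) :
    I.sepSet c ⊆ I.P := fun _ h => h.1

/-- `FindSep` succeeds in the context `c`. -/
def FindSep (I : ImitationProblem V D) (c : PartialAssignment D) : Prop :=
  DiGraph.DSep (DiGraph.removeOut (I.G.contextDAG c) I.X) I.X I.Y (I.sepSet c)

variable [∀ v, MeasurableSpace (D v)]

/-- Stochastic mappings from the values of `P` to the action; a policy is one that is Markov. -/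
abbrev PrePolicy (I : ImitationProblem V D) : Type (max uV uD) :=
  Kernel (∀ v : I.P, D v) (D I.X)

/-- `π(X | P)` is (a version of) the conditional distribution `P(X | Z, C = c)`. -/
def IsCondPolicy (I : ImitationProblem V D) (PO : Measure (∀ v : I.O, D v))
    (c : PartialAssignment D) (Z : Set V) (hZ : Z ⊆ I.P) (π : I.PrePolicy) : Prop :=
  ∃ κ : Kernel (∀ v : Z, D v) (D I.X), IsMarkovKernel κ ∧
    (cond PO {o | c.AgreesOn o}).map
        (fun o => (Set.domRestrict₂ (hZ.trans I.P_subset) o, o ⟨I.X, I.X_mem⟩)) =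
      ((cond PO {o | c.AgreesOn o}).map (Set.domRestrict₂ (hZ.trans I.P_subset))).compProd κ ∧
    ∀ p, π p = κ (Set.domRestrict₂ hZ p)

/-- `T` is a possible output of `FindMinSep` in the context `c`: a minimal one among the sets of
observable variables that contain the context variables and d-separate `X` and `Y` in the
context-specific DAG with the edges from `P` to `X` added. -/
def IsMinSep (I : ImitationProblem V D) (c : PartialAssignment D) (T : Set V) : Prop :=
  Minimal (fun T => c.dom ⊆ T ∧ T ⊆ I.O \ {I.X} ∧
    DiGraph.DSep (DiGraph.addParents (I.G.contextDAG c) I.P I.X) I.X I.Y T) T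

/-- The effect `P(S | do(π), C = c)` is identified as `q`: it equals `q` in every model that is
compatible with the LDAG and induces the observational distribution `PO`. -/
def EffectIdentifiedAs [Fintype V] [DecidableEq V] (I : ImitationProblem V D)
    (PO : Measure (∀ v : I.O, D v)) (c : PartialAssignment D) (S : Set V) (π : I.PrePolicy)
    (q : Measure (∀ v : S, D v)) : Prop :=
  ∀ M : SCM.{uV, uD, uU} I.G, M.obs I.O = PO →
    (cond (M.lawDo I.X I.P π) {w | c.Agrees w}).map S.domRestrict = q

/-- `I.SubImitate PO c π`: some run of the recursive subroutine in the context `c` returns `π`.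

* `sep`: `FindSep` succeeds, and the policy `P(X | Z_c, C = c)` is returned.
* `surrogate`: `FindSep` fails, `FindMinSep` returns `T`, and for `S = T \ C` the effect
  `P(S | do(π), c)` is identified and the policy `π` solves `P(S | do(π), c) = P(S | c)`.
* `branch`: `FindSep` fails and no policy was returned through a surrogate; some further context
  variable `W` in `P` is chosen, the subroutine returns a policy for each of its values, and these
  are glued along the value of `W`.

The identification subroutine need not be complete: it may fail on any query, so that `branch` has
no premise on it.  There is no constructor for a run that fails. -/
inductive SubImitate [Fintype V] [DecidableEq V] (I : ImitationProblem V D)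
    (PO : Measure (∀ v : I.O, D v)) : PartialAssignment D → I.PrePolicy → Prop
  | sep (c : PartialAssignment D) (π : I.PrePolicy) (hπ : IsMarkovKernel π)
      (hsep : I.FindSep c)
      (hcond : I.IsCondPolicy PO c (I.sepSet c) (I.sepSet_subset c) π) :
      SubImitate I PO c π
  | surrogate (c : PartialAssignment D) (π : I.PrePolicy) (hπ : IsMarkovKernel π)
      (hsep : ¬ I.FindSep c)
      (T : Set V) (hT : I.IsMinSep c T) (hTO : T \ c.dom ⊆ I.O)
      (q : Measure (∀ v : (T \ c.dom : Set V), D v))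
      (hid : EffectIdentifiedAs.{uV, uD, uU} I PO c (T \ c.dom) π q)
      (hsolve : q = (cond PO {o | c.AgreesOn o}).map (Set.domRestrict₂ hTO)) :
      SubImitate I PO c π
  | branch (c : PartialAssignment D) (π : I.PrePolicy) (hπ : IsMarkovKernel π)
      (hsep : ¬ I.FindSep c)
      (W : V) (hW : W ∈ I.G.contextVars) (hWP : W ∈ I.P) (hWc : W ∉ c.dom)
      (πs : D W → I.PrePolicy)
      (hrec : ∀ a : D W, SubImitate I PO (Function.update c W (some a)) (πs a))
      (hglue : ∀ p : ∀ v : I.P, D v, π p = πs (p ⟨W, hWP⟩) p) :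
      SubImitate I PO c π

/-- Some run of the algorithm returns the policy `π`. -/
def Imitate2 [Fintype V] [DecidableEq V] (I : ImitationProblem V D)
    (PO : Measure (∀ v : I.O, D v)) (π : I.PrePolicy) : Prop :=
  SubImitate.{uV, uD, uU} I PO PartialAssignment.empty π

/-- `π` is an imitating policy for `P(y)` w.r.t. the LDAG, the policy space and `PO`: it is a policy,
and `P^M(y | do(π)) = P^M(y)` for every compatible model `M` that induces `PO`. -/
def IsImitatingPolicy [Fintype V] [DecidableEq V] (I : ImitationProblem V D)
    (PO : Measure (∀ v : I.O, D v)) (π : I.PrePolicy) : Prop :=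
  IsMarkovKernel π ∧ ∀ M : SCM.{uV, uD, uU} I.G, M.obs I.O = PO →
    (M.lawDo I.X I.P π).map (fun w => w I.Y) = M.law.map (fun w => w I.Y)

end ImitationProblem

/-! The statement proved along a run is local: for a policy returned in context `c`, the events `{Y
∈ F} ∩ {c}` have the same mass under `M.law` and under `M.lawDo`. Joint masses are used instead of
conditional ones, so null contexts need no separate treatment in the recursion, and the masses of
the contexts `c ∪ {W = a}` add up over the countable domain of `W`. On `W = a` the glued policy is
the one returned for `a`, and `W` is not a descendant of the action. So a branching step only sums
up what is known for the recursive calls, and the empty context gives the theorem.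

For the two kinds of leaves, the observational and the interventional law are put side by side on
`Bool × ∀ v, D v`, the Boolean being a regime indicator that acts as one more parent of `X` only.
If, in the context, `Z` separates the reward from this indicator, then both regimes share one
version of the conditional probability of a reward event given `Z`. It then suffices that the two
laws agree on `Z` in the context (`SCM.law_eq_lawDo_of_partition`). When `FindSep` succeeds, the
separator is `Z_c ∪ {X}`, where the laws agree because the policy is the conditional law of `X`
given `Z_c`. For a surrogate the separator is `T`, where they agree by identification and by the
equation that the policy solves.

The separation statement needs two ingredients. Graphically, d-separation splits the relevant
vertices into `L`, `Z`, `R` such that the parents of each vertex lie in `L ∪ Z` or in `R ∪ Z`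
(`DSep.exists_partition`, by moralizing the ancestral graph). Probabilistically, the variables are
revealed in a topological order of the full graph, and conditional independence of the two sides
given `Z` is preserved at each step (`isCondIndep_of_localMarkov`). Context-specific edges come in
as follows: where the revealed variables agree with `c`, the mechanism of the next variable ignores
the parents whose edge is absent. The context is therefore imposed gradually, one variable at a
time; conditioning on its unrevealed part would distort the mechanisms.

Since the domains are arbitrary measurable spaces, regular conditional distributions may fail to
exist, and everything is expressed by σ-algebras and versions of conditional probabilities of single
events. -/

/-! ### Conditional independence of σ-algebras -/

namespace MeasureTheory

open scoped ENNReal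

variable {Ω : Type*} {m m' m₁ m₂ m₃ mΩ : MeasurableSpace Ω}

/-- The measures `ν.restrict B` and `ν.withDensity b` agree on `m`, hence integrate `m`-measurable
functions alike. The density `b` need not be `m`-measurable, so the lemma also applies to a coarser
or a finer `m` than that of `b`. -/
theorem setLIntegral_eq_lintegral_mul_of_trim (hm : m ≤ mΩ) {ν : Measure Ω} {B : Set Ω}
    {b : Ω → ℝ≥0∞} (hb : Measurable[mΩ] b)
    (h : ∀ A, MeasurableSet[m] A → ν (A ∩ B) = ∫⁻ x in A, b x ∂ν)
    {φ : Ω → ℝ≥0∞} (hφ : Measurable[m] φ) :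
    ∫⁻ x in B, φ x ∂ν = ∫⁻ x, φ x * b x ∂ν := by
  have key : (ν.restrict B).trim hm = (ν.withDensity b).trim hm := by
    refine @Measure.ext _ m _ _ fun s hs => ?_
    rw [trim_measurableSet_eq hm hs, trim_measurableSet_eq hm hs,
      Measure.restrict_apply (hm s hs), withDensity_apply _ (hm s hs), h s hs]
  calc ∫⁻ x in B, φ x ∂ν = ∫⁻ x, φ x ∂((ν.restrict B).trim hm) := (lintegral_trim hm hφ).symm
    _ = ∫⁻ x, φ x ∂(ν.withDensity b) := by rw [key, lintegral_trim hm hφ]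
    _ = ∫⁻ x, φ x * b x ∂ν := by
      rw [lintegral_withDensity_eq_lintegral_mul ν hb (hφ.mono hm le_rfl)]
      simp only [Pi.mul_apply, mul_comm]

/-- Two finite measures that agree on the intersections `A ∩ E` of the events of two σ-algebras
agree on their supremum. -/
theorem measure_eq_of_sup (h₁ : m₁ ≤ mΩ) (h₃ : m₃ ≤ mΩ) {ρ₁ ρ₂ : Measure Ω} [IsFiniteMeasure ρ₁]
    (h : ∀ A E, MeasurableSet[m₁] A → MeasurableSet[m₃] E → ρ₁ (A ∩ E) = ρ₂ (A ∩ E))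
    {s : Set Ω} (hs : MeasurableSet[m₁ ⊔ m₃] s) : ρ₁ s = ρ₂ s := by
  set C : Set (Set Ω) := {t | ∃ A E, MeasurableSet[m₁] A ∧ MeasurableSet[m₃] E ∧ A ∩ E = t}
  have hC : m₁ ⊔ m₃ = MeasurableSpace.generateFrom C := by
    refine le_antisymm (sup_le ?_ ?_) (MeasurableSpace.generateFrom_le ?_)
    · exact fun A hA => MeasurableSpace.measurableSet_generateFrom
        ⟨A, Set.univ, hA, MeasurableSet.univ, by simp⟩
    · exact fun E hE => MeasurableSpace.measurableSet_generateFrom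
        ⟨Set.univ, E, MeasurableSet.univ, hE, by simp⟩
    · rintro t ⟨A, E, hA, hE, rfl⟩
      exact MeasurableSet.inter (le_sup_left (b := m₃) A hA) (le_sup_right (a := m₁) E hE)
  have hpi : IsPiSystem C := by
    rintro _ ⟨A, E, hA, hE, rfl⟩ _ ⟨A', E', hA', hE', rfl⟩ -
    exact ⟨A ∩ A', E ∩ E', hA.inter hA', hE.inter hE', by
      ext x; simp only [Set.mem_inter_iff]; tauto⟩
  have hle : m₁ ⊔ m₃ ≤ mΩ := sup_le h₁ h₃
  have key : ρ₁.trim hle = ρ₂.trim hle := by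
    refine @ext_of_generate_finite Ω (m₁ ⊔ m₃) (ρ₁.trim hle) (ρ₂.trim hle) C hC hpi
      (isFiniteMeasure_trim hle) ?_ ?_
    · rintro _ ⟨A, E, hA, hE, rfl⟩
      have hAE : MeasurableSet[m₁ ⊔ m₃] (A ∩ E) :=
        MeasurableSet.inter (le_sup_left (b := m₃) A hA) (le_sup_right (a := m₁) E hE)
      rw [trim_measurableSet_eq hle hAE, trim_measurableSet_eq hle hAE, h A E hA hE]
    · rw [trim_measurableSet_eq hle MeasurableSet.univ,
        trim_measurableSet_eq hle MeasurableSet.univ]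
      simpa using h Set.univ Set.univ MeasurableSet.univ MeasurableSet.univ
  rw [← trim_measurableSet_eq hle hs, ← trim_measurableSet_eq hle hs, key]

theorem exists_condLExp_indicator (hm : m ≤ mΩ) (ν : Measure Ω) [IsFiniteMeasure ν] {B : Set Ω}
    (hB : MeasurableSet[mΩ] B) :
    ∃ b : Ω → ℝ≥0∞, Measurable[m] b ∧
      ∀ A, MeasurableSet[m] A → ν (A ∩ B) = ∫⁻ x in A, b x ∂ν := by
  refine ⟨condLExp m ν (B.indicator 1), measurable_condLExp m ν _, fun A hA => ?_⟩
  rw [setLIntegral_condLExp hm ν _ hA, lintegral_indicator_one hB, Measure.restrict_apply hB,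
    Set.inter_comm]

/-- The σ-algebras `m₁` and `m₂` are conditionally independent given `m'`; used for
`m' ≤ m₁` and `m' ≤ m₂`. -/
def IsCondIndep (m' m₁ m₂ : MeasurableSpace Ω) {mΩ : MeasurableSpace Ω} (ν : Measure Ω) : Prop :=
  ∀ A, MeasurableSet[m₁] A → ∃ a : Ω → ℝ≥0∞, Measurable[m'] a ∧
    ∀ B, MeasurableSet[m₂] B → ν (A ∩ B) = ∫⁻ x in B, a x ∂ν

namespace IsCondIndep

variable {ν : Measure Ω}

theorem of_le (h₁ : m₁ ≤ mΩ) (h : m₁ ≤ m') : IsCondIndep m' m₁ m₂ ν := by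
  refine fun A hA => ⟨A.indicator 1,
    Measurable.indicator (@measurable_const _ _ _ m' 1) (h A hA), fun B _ => ?_⟩
  rw [lintegral_indicator_one (h₁ A hA), Measure.restrict_apply (h₁ A hA)]

/-- With `b` the conditional probability of `B` given `m'`, both `ν (A ∩ B)` and `∫⁻ x in A, b x ∂ν`
equal `∫⁻ x, a x * b x ∂ν`. -/
theorem symm [IsFiniteMeasure ν] (h : IsCondIndep m' m₁ m₂ ν) (h₁ : m₁ ≤ mΩ) (h₂ : m₂ ≤ mΩ)
    (h'₁ : m' ≤ m₁) (h'₂ : m' ≤ m₂) : IsCondIndep m' m₂ m₁ ν := by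
  intro B hB
  obtain ⟨b, hb, hbB⟩ := exists_condLExp_indicator (h'₁.trans h₁) ν (h₂ B hB)
  refine ⟨b, hb, fun A hA => ?_⟩
  obtain ⟨a, ha, haA⟩ := h A hA
  have hbΩ : Measurable[mΩ] b := hb.mono (h'₁.trans h₁) le_rfl
  have haΩ : Measurable[mΩ] a := ha.mono (h'₁.trans h₁) le_rfl
  rw [Set.inter_comm, haA B hB, setLIntegral_eq_lintegral_mul_of_trim (h'₁.trans h₁) hbΩ hbB ha,
    setLIntegral_eq_lintegral_mul_of_trim h₂ haΩ (fun C hC => by rw [Set.inter_comm, haA C hC])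
      (hb.mono h'₂ le_rfl)]
  simp only [mul_comm]

/-- Contraction: by `hk`, the events of `m₃` depend on `m₁ ⊔ m₂` only through `m₁`. The version `b`
of the probability of `B` given `m₁` still serves given `m₁ ⊔ m₃`: on `A ∩ E`, both sides are the
integral of `k * b` over `A`. -/
theorem sup_left [IsFiniteMeasure ν] (h : IsCondIndep m' m₁ m₂ ν) (h₁ : m₁ ≤ mΩ) (h₂ : m₂ ≤ mΩ)
    (h₃ : m₃ ≤ mΩ) (h'₁ : m' ≤ m₁) (h'₂ : m' ≤ m₂)
    (hk : ∀ E, MeasurableSet[m₃] E → ∃ k : Ω → ℝ≥0∞, Measurable[m₁] k ∧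
      ∀ B, MeasurableSet[m₁ ⊔ m₂] B → ν (E ∩ B) = ∫⁻ x in B, k x ∂ν) :
    IsCondIndep m' (m₁ ⊔ m₃) m₂ ν := by
  suffices IsCondIndep m' m₂ (m₁ ⊔ m₃) ν from
    this.symm h₂ (sup_le h₁ h₃) h'₂ (h'₁.trans le_sup_left)
  intro B hB
  obtain ⟨b, hb, hbB⟩ := h.symm h₁ h₂ h'₁ h'₂ B hB
  have hbΩ : Measurable[mΩ] b := hb.mono (h'₁.trans h₁) le_rfl
  refine ⟨b, hb, fun s hs => ?_⟩
  have hBΩ := h₂ B hB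
  rw [Set.inter_comm, ← Measure.restrict_apply (sup_le h₁ h₃ s hs),
    ← withDensity_apply _ (sup_le h₁ h₃ s hs)]
  refine measure_eq_of_sup h₁ h₃ (fun A E hA hE => ?_) hs
  have hAΩ := h₁ A hA
  have hEΩ := h₃ E hE
  obtain ⟨k, hk₁, hkE⟩ := hk E hE
  have hkΩ : Measurable[mΩ] k := hk₁.mono h₁ le_rfl
  have e₁ : ν (A ∩ E ∩ B) = ∫⁻ x in B, A.indicator k x ∂ν := by
    rw [show A ∩ E ∩ B = E ∩ (A ∩ B) by ext; simp only [Set.mem_inter_iff]; tauto,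
      hkE _ (MeasurableSet.inter (le_sup_left (b := m₂) A hA) (le_sup_right (a := m₁) B hB)),
      lintegral_indicator hAΩ, Measure.restrict_restrict hAΩ]
  have e₂ : ∫⁻ x in A ∩ E, b x ∂ν = ∫⁻ x, A.indicator b x * k x ∂ν := by
    rw [Set.inter_comm, ← setLIntegral_eq_lintegral_mul_of_trim (m := m₁) (B := E) h₁ hkΩ
      (fun C hC => by rw [Set.inter_comm, hkE C (le_sup_left (b := m₂) C hC)])
      ((hb.mono h'₁ le_rfl).indicator hA), lintegral_indicator hAΩ, Measure.restrict_restrict hAΩ,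
      Set.inter_comm]
  rw [Measure.restrict_apply (hAΩ.inter hEΩ), withDensity_apply _ (hAΩ.inter hEΩ), e₁, e₂,
    setLIntegral_eq_lintegral_mul_of_trim (m := m₁) h₁ hbΩ
      (fun C hC => by rw [Set.inter_comm, hbB C hC]) (hk₁.indicator hA)]
  refine lintegral_congr fun x => ?_
  by_cases hx : x ∈ A <;> simp [hx, mul_comm]

/-- Weak union: a part of one side may be moved into the condition. On `B ∩ E`, both sides are the
integral over `E` of the product of the conditional probabilities `a` and `b`. -/
theorem shift [IsFiniteMeasure ν] (h : IsCondIndep m' m₁ m₂ ν) (h₁ : m₁ ≤ mΩ) (h₂ : m₂ ≤ mΩ)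
    (h₃ : m₃ ≤ m₁) (h'₁ : m' ≤ m₁) (h'₂ : m' ≤ m₂) :
    IsCondIndep (m' ⊔ m₃) m₁ (m₂ ⊔ m₃) ν := by
  intro A hA
  have h'₃ : m' ⊔ m₃ ≤ m₁ := sup_le h'₁ h₃
  have hAΩ := h₁ A hA
  obtain ⟨a, ha, haA⟩ := exists_condLExp_indicator (h'₃.trans h₁) ν hAΩ
  have haΩ : Measurable[mΩ] a := ha.mono (h'₃.trans h₁) le_rfl
  refine ⟨a, ha, fun s hs => ?_⟩
  have h₃Ω := h₃.trans h₁
  rw [Set.inter_comm, ← Measure.restrict_apply' hAΩ, ← withDensity_apply _ (sup_le h₂ h₃Ω s hs)]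
  refine measure_eq_of_sup h₂ h₃Ω (fun B E hB hE => ?_) hs
  have hBΩ := h₂ B hB
  have hEΩ := h₃Ω E hE
  obtain ⟨b, hb, hbB⟩ := h.symm h₁ h₂ h'₁ h'₂ B hB
  have hbΩ : Measurable[mΩ] b := hb.mono (h'₁.trans h₁) le_rfl
  have hb' : Measurable[m' ⊔ m₃] (E.indicator b) :=
    (hb.mono le_sup_left le_rfl).indicator (le_sup_right (a := m') E hE)
  have ha₁ : Measurable[m₁] (E.indicator a) := (ha.mono h'₃ le_rfl).indicator (h₃ E hE)
  have e₁ : ν (B ∩ E ∩ A) = ∫⁻ x, E.indicator b x * a x ∂ν := by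
    rw [show B ∩ E ∩ A = B ∩ (E ∩ A) by rw [Set.inter_assoc],
      hbB _ (MeasurableSet.inter (h₃ E hE) hA),
      ← setLIntegral_eq_lintegral_mul_of_trim (B := A) (h'₃.trans h₁) haΩ haA hb',
      lintegral_indicator hEΩ, Measure.restrict_restrict hEΩ]
  have e₂ : ∫⁻ x in B ∩ E, a x ∂ν = ∫⁻ x, E.indicator a x * b x ∂ν := by
    rw [← setLIntegral_eq_lintegral_mul_of_trim (B := B) h₁ hbΩ
      (fun C hC => by rw [Set.inter_comm, hbB C hC]) ha₁,
      lintegral_indicator hEΩ, Measure.restrict_restrict hEΩ, Set.inter_comm]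
  rw [Measure.restrict_apply' hAΩ, withDensity_apply _ (hBΩ.inter hEΩ), e₁, e₂]
  refine lintegral_congr fun x => ?_
  by_cases hx : x ∈ E <;> simp [hx, mul_comm]

theorem restrict (h : IsCondIndep m' m₁ m₂ ν) (hm₂ : m₂ ≤ mΩ) (h'₂ : m' ≤ m₂) {c : Set Ω}
    (hc : MeasurableSet[m'] c) : IsCondIndep m' m₁ m₂ (ν.restrict c) := by
  intro A hA
  obtain ⟨a, ha, haA⟩ := h A hA
  refine ⟨a, ha, fun B hB => ?_⟩
  have hcΩ := hm₂ c (h'₂ c hc)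
  rw [Measure.restrict_apply' hcΩ, Set.inter_assoc, haA _ (MeasurableSet.inter hB (h'₂ c hc)),
    Measure.restrict_restrict (hm₂ B hB)]

end IsCondIndep

end MeasureTheory

/-! ### Topological induction over ancestral sets -/

namespace DiGraph

variable {V : Type*} {E : V → V → Prop}

/-- The set `S` contains the tails of all edges that end in it. -/
def IsAncestral (E : V → V → Prop) (S : Set V) : Prop := ∀ b ∈ S, ∀ a, E a b → a ∈ S

theorem IsAncestral.mono {E' : V → V → Prop} {S : Set V} (h : IsAncestral E S)
    (hE : ∀ a b, E' a b → E a b) : IsAncestral E' S := fun b hb a hab => h b hb a (hE a b hab)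

/-- A nonempty ancestral set has a vertex without descendants in the set; removing it leaves an
ancestral set that contains all its parents. -/
theorem isAncestral_induction [Finite V] (hE : ∀ v, ¬ Relation.TransGen E v v)
    {p : Set V → Prop} (empty : p ∅)
    (insert : ∀ S v, IsAncestral E S → v ∉ S → (∀ a, E a v → a ∈ S) → p S → p (insert v S))
    {S : Set V} (hS : IsAncestral E S) : p S := by
  have : IsTrans V (fun a b => Relation.TransGen E b a) := ⟨fun _ _ _ h h' => h'.trans h⟩
  have : Std.Irrefl (fun a b => Relation.TransGen E b a) := ⟨hE⟩
  have hwf := Finite.wellFounded_of_trans_of_irrefl (fun a b => Relation.TransGen E b a)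
  induction hn : S.ncard generalizing S with
  | zero => rwa [(Set.ncard_eq_zero).1 hn]
  | succ n ih =>
    obtain ⟨v, hv, hmax⟩ := hwf.has_min S (Set.nonempty_of_ncard_ne_zero (by omega))
    have hS' : IsAncestral E (S \ {v}) := fun b hb a hab => ⟨hS b hb.1 a hab, by
      rintro rfl; exact hmax b hb.1 (.single hab)⟩
    have key := insert (S \ {v}) v hS' (by simp) (fun a ha => ⟨hS v hv a ha, by
      rintro rfl; exact hE _ (.single ha)⟩) (ih hS' (by
        have := Set.ncard_sdiff_singleton_add_one hv; omega))
    rwa [Set.insert_sdiff_singleton, Set.insert_eq_of_mem hv] at key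

end DiGraph

/-! ### From local Markov properties to conditional independence -/

namespace MeasureTheory

open scoped ENNReal
open DiGraph

variable {Ω V : Type*} {m₀ m₁ mΩ : MeasurableSpace Ω}

/-- The σ-algebra generated by the variables in `S`. -/
@[reducible]
def sigmaOf (m : V → MeasurableSpace Ω) (S : Set V) : MeasurableSpace Ω := ⨆ v ∈ S, m v

section sigmaOf

variable {m : V → MeasurableSpace Ω} {S T : Set V}

theorem le_sigmaOf {v : V} (hv : v ∈ S) : m v ≤ sigmaOf m S := le_iSup₂ (f := fun v _ => m v) v hv

theorem sigmaOf_le {m' : MeasurableSpace Ω} (h : ∀ v ∈ S, m v ≤ m') : sigmaOf m S ≤ m' :=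
  iSup₂_le h

theorem sigmaOf_mono (h : S ⊆ T) : sigmaOf m S ≤ sigmaOf m T :=
  sigmaOf_le fun _ hv => le_sigmaOf (h hv)

theorem sigmaOf_union : sigmaOf m (S ∪ T) = sigmaOf m S ⊔ sigmaOf m T := iSup_union

theorem sigmaOf_inter_insert_of_mem {v : V} (hv : v ∈ T) :
    sigmaOf m (T ∩ insert v S) = sigmaOf m (T ∩ S) ⊔ m v := by
  rw [Set.inter_insert_of_mem hv, Set.insert_eq, Set.union_comm, sigmaOf_union]
  simp [sigmaOf]

theorem sigmaOf_inter_insert_of_notMem {v : V} (hv : v ∉ T) :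
    sigmaOf m (T ∩ insert v S) = sigmaOf m (T ∩ S) := by
  rw [Set.inter_insert_of_notMem hv]

end sigmaOf

/-- Revealing `v` enlarges the left side by contraction. If `v ∈ Z`, weak union then moves it into
the condition and the right side as well; otherwise these do not change, as `v ∉ R`. The extra
σ-algebras `m₀` and `m₁` let the same lemma serve the mirrored case. -/
theorem IsCondIndep.insert_left {m : V → MeasurableSpace Ω} (hm : ∀ v, m v ≤ mΩ)
    (hm₀ : m₀ ≤ mΩ) (hm₁ : m₁ ≤ mΩ) {ν : Measure Ω} [IsFiniteMeasure ν]
    {L Z R S : Set V} {v : V} (hv : v ∈ L ∪ Z) (hvR : v ∉ R)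
    (hk : ∀ F, MeasurableSet[m v] F → ∃ k : Ω → ℝ≥0∞,
      Measurable[m₀ ⊔ sigmaOf m ((L ∪ Z) ∩ S)] k ∧
      ∀ B, MeasurableSet[m₀ ⊔ m₁ ⊔ sigmaOf m S] B → ν (F ∩ B) = ∫⁻ x in B, k x ∂ν)
    (h : IsCondIndep (sigmaOf m (Z ∩ S)) (m₀ ⊔ sigmaOf m ((L ∪ Z) ∩ S))
      (m₁ ⊔ sigmaOf m ((R ∪ Z) ∩ S)) ν) :
    IsCondIndep (sigmaOf m (Z ∩ insert v S)) (m₀ ⊔ sigmaOf m ((L ∪ Z) ∩ insert v S))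
      (m₁ ⊔ sigmaOf m ((R ∪ Z) ∩ insert v S)) ν := by
  have hle : ∀ T, sigmaOf m T ≤ mΩ := fun T => sigmaOf_le fun v _ => hm v
  have hL : sigmaOf m (Z ∩ S) ≤ m₀ ⊔ sigmaOf m ((L ∪ Z) ∩ S) :=
    (sigmaOf_mono (Set.inter_subset_inter_left _ Set.subset_union_right)).trans le_sup_right
  have hR : sigmaOf m (Z ∩ S) ≤ m₁ ⊔ sigmaOf m ((R ∪ Z) ∩ S) :=
    (sigmaOf_mono (Set.inter_subset_inter_left _ Set.subset_union_right)).trans le_sup_right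
  have key := h.sup_left (sup_le hm₀ (hle _)) (sup_le hm₁ (hle _)) (hm v) hL hR fun F hF => by
    obtain ⟨k, hk, hkF⟩ := hk F hF
    refine ⟨k, hk, fun B hB => hkF B ((sup_le (sup_le ?_ ?_) (sup_le ?_ ?_) :
      (_ : MeasurableSpace Ω) ≤ _) B hB)⟩
    · exact le_sup_left.trans le_sup_left
    · exact (sigmaOf_mono Set.inter_subset_right).trans le_sup_right
    · exact le_sup_right.trans le_sup_left
    · exact (sigmaOf_mono Set.inter_subset_right).trans le_sup_right
  rw [sigmaOf_inter_insert_of_mem hv, ← sup_assoc]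
  by_cases hvZ : v ∈ Z
  · rw [sigmaOf_inter_insert_of_mem hvZ, sigmaOf_inter_insert_of_mem (T := R ∪ Z) (Or.inr hvZ),
      ← sup_assoc]
    exact key.shift (sup_le (sup_le hm₀ (hle _)) (hm v)) (sup_le hm₁ (hle _)) le_sup_right
      (hL.trans le_sup_left) hR
  · rwa [sigmaOf_inter_insert_of_notMem hvZ,
      sigmaOf_inter_insert_of_notMem (by simp [hvR, hvZ])]

/-- Soundness of separation.  The variables are revealed along an ancestral order; when `v` is
revealed, its conditional law given the past, within the part `⋂ v ∈ S, c v` of the context, depends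
only on variables of `L ∪ Z` or only on variables of `R ∪ Z`. -/
theorem isCondIndep_of_localMarkov [Finite V] {E : V → V → Prop}
    (hE : ∀ v, ¬ Relation.TransGen E v v) {m : V → MeasurableSpace Ω} (hm : ∀ v, m v ≤ mΩ)
    (hm₀ : m₀ ≤ mΩ) {c : V → Set Ω} (hc : ∀ v, MeasurableSet[m v] (c v))
    {L Z R : Set V} (hcZ : ∀ v ∉ Z, c v = Set.univ) {μ : Measure Ω} [IsFiniteMeasure μ]
    (hk : ∀ v ∈ L ∪ Z ∪ R, ∀ S, IsAncestral E S → v ∉ S → (∀ a, E a v → a ∈ S) →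
      (v ∉ R ∧ ∀ F, MeasurableSet[m v] F → ∃ k : Ω → ℝ≥0∞,
        Measurable[m₀ ⊔ sigmaOf m ((L ∪ Z) ∩ S)] k ∧ ∀ B, MeasurableSet[m₀ ⊔ sigmaOf m S] B →
          μ.restrict (⋂ v ∈ S, c v) (F ∩ B) = ∫⁻ x in B, k x ∂μ.restrict (⋂ v ∈ S, c v)) ∨
      (v ∉ L ∧ ∀ F, MeasurableSet[m v] F → ∃ k : Ω → ℝ≥0∞,
        Measurable[sigmaOf m ((R ∪ Z) ∩ S)] k ∧ ∀ B, MeasurableSet[m₀ ⊔ sigmaOf m S] B →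
          μ.restrict (⋂ v ∈ S, c v) (F ∩ B) = ∫⁻ x in B, k x ∂μ.restrict (⋂ v ∈ S, c v))) :
    IsCondIndep (sigmaOf m Z) (m₀ ⊔ sigmaOf m (L ∪ Z)) (sigmaOf m (R ∪ Z))
      (μ.restrict (⋂ v, c v)) := by
  have hle : ∀ T, sigmaOf m T ≤ mΩ := fun T => sigmaOf_le fun v _ => hm v
  have hL : ∀ S, sigmaOf m (Z ∩ S) ≤ m₀ ⊔ sigmaOf m ((L ∪ Z) ∩ S) := fun S =>
    (sigmaOf_mono (Set.inter_subset_inter_left _ Set.subset_union_right)).trans le_sup_right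
  have hR : ∀ S, sigmaOf m (Z ∩ S) ≤ ⊥ ⊔ sigmaOf m ((R ∪ Z) ∩ S) := fun S =>
    (sigmaOf_mono (Set.inter_subset_inter_left _ Set.subset_union_right)).trans le_sup_right
  -- The summand `⊥` gives both sides the shape required by `IsCondIndep.insert_left`.
  suffices IsCondIndep (sigmaOf m (Z ∩ Set.univ)) (m₀ ⊔ sigmaOf m ((L ∪ Z) ∩ Set.univ))
      (⊥ ⊔ sigmaOf m ((R ∪ Z) ∩ Set.univ)) (μ.restrict (⋂ v ∈ Set.univ, c v)) by simpa using this
  refine isAncestral_induction (E := E) (p := fun S => IsCondIndep (sigmaOf m (Z ∩ S))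
    (m₀ ⊔ sigmaOf m ((L ∪ Z) ∩ S)) (⊥ ⊔ sigmaOf m ((R ∪ Z) ∩ S)) (μ.restrict (⋂ v ∈ S, c v)))
    hE ?_ ?_ (fun _ _ _ _ => Set.mem_univ _)
  · refine IsCondIndep.symm (IsCondIndep.of_le (sup_le bot_le (hle _)) ?_)
      (sup_le bot_le (hle _)) (sup_le hm₀ (hle _)) (hR _) (hL _)
    simp [sigmaOf]
  · intro S v hS hvS hpa ih
    have hcS : ⋂ w ∈ insert v S, c w = c v ∩ ⋂ w ∈ S, c w := Set.biInter_insert _ _ _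
    -- The σ-algebras are enlarged under the old restriction, where the conditional law of `v` is
    -- known. Restricting to `c v` afterwards is harmless, since `c v` is trivial or belongs to the
    -- new condition.
    rw [hcS, ← Measure.restrict_restrict (hm v _ (hc v))]
    by_cases hv : v ∈ L ∪ Z ∪ R
    · have key : IsCondIndep (sigmaOf m (Z ∩ insert v S))
          (m₀ ⊔ sigmaOf m ((L ∪ Z) ∩ insert v S))
          (⊥ ⊔ sigmaOf m ((R ∪ Z) ∩ insert v S)) (μ.restrict (⋂ v ∈ S, c v)) := by
        rcases hk v hv S hS hvS hpa with ⟨hvR, hk⟩ | ⟨hvL, hk⟩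
        · refine ih.insert_left hm hm₀ bot_le ?_ hvR (by rw [sup_bot_eq]; exact hk)
          rcases hv with hv | hv
          · exact hv
          · exact absurd hv hvR
        · refine (IsCondIndep.insert_left hm bot_le hm₀ ?_ hvL ?_ (ih.symm (sup_le hm₀ (hle _))
            (sup_le bot_le (hle _)) (hL _) (hR _))).symm (sup_le bot_le (hle _))
            (sup_le hm₀ (hle _)) (hR _) (hL _)
          · rcases hv with (hv | hv) | hv
            · exact absurd hv hvL
            · exact Or.inr hv
            · exact Or.inl hv
          · rw [bot_sup_eq, bot_sup_eq]; exact hk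
      by_cases hvZ : v ∈ Z
      · exact key.restrict (sup_le bot_le (hle _)) (hR _)
          (le_sigmaOf (S := Z ∩ insert v S) ⟨hvZ, Set.mem_insert _ _⟩ _ (hc v))
      · rwa [hcZ v hvZ, Measure.restrict_univ]
    · simp only [Set.mem_union, not_or] at hv
      rw [hcZ v hv.1.2, Measure.restrict_univ, sigmaOf_inter_insert_of_notMem hv.1.2,
        sigmaOf_inter_insert_of_notMem (by simp [hv]),
        sigmaOf_inter_insert_of_notMem (by simp [hv])]
      exact ih

end MeasureTheory

/-! ### d-separation: active walks and the moral graph -/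

namespace DiGraph

variable {V : Type*} {E : V → V → Prop} {Z : Set V} {X Y : V}

/-- `v` is an ancestor of an element of `Z`. -/
def IsAncestorOf (E : V → V → Prop) (Z : Set V) (v : V) : Prop :=
  ∃ d ∈ Z, Relation.ReflTransGen E v d

theorem IsAncestorOf.of_edge {a b : V} (h : IsAncestorOf E Z b) (hab : E a b) :
    IsAncestorOf E Z a := by
  obtain ⟨d, hd, hbd⟩ := h
  exact ⟨d, hd, .head hab hbd⟩

theorem isAncestorOf_of_mem {a : V} (h : a ∈ Z) : IsAncestorOf E Z a := ⟨a, h, .refl⟩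

theorem irrefl_of_acyclic (hE : ∀ v, ¬ Relation.TransGen E v v) (a : V) : ¬ E a a :=
  fun h => hE a (.single h)

theorem asymm_of_acyclic (hE : ∀ v, ¬ Relation.TransGen E v v) {a b : V} (h : E a b) : ¬ E b a :=
  fun h' => hE a (.tail (.single h) h')

/-- The consecutive vertices `a`, `m`, `b` of a walk do not block it. -/
def Open (E : V → V → Prop) (Z : Set V) (a m b : V) : Prop :=
  (E a m ∧ E b m → IsAncestorOf E Z m) ∧ (¬ (E a m ∧ E b m) → m ∉ Z)

/-- No three consecutive vertices of the walk block it. -/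
def Unblocked (E : V → V → Prop) (Z : Set V) : List V → Prop
  | a :: m :: b :: l => Open E Z a m b ∧ Unblocked E Z (m :: b :: l)
  | _ => True

theorem Unblocked.tail : ∀ {a : V} {l : List V}, Unblocked E Z (a :: l) → Unblocked E Z l
  | _, [], _ => trivial
  | _, [_], _ => trivial
  | _, _ :: _ :: _, h => h.2

theorem Unblocked.of_append_right {p l : List V} (h : Unblocked E Z (p ++ l)) :
    Unblocked E Z l := by
  induction p with
  | nil => exact h
  | cons a p ih => exact ih h.tail

theorem Unblocked.of_append_left : ∀ {p l : List V}, Unblocked E Z (p ++ l) → Unblocked E Z p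
  | [], _, _ => trivial
  | [_], _, _ => trivial
  | [_, _], _, _ => trivial
  | _ :: b :: c :: p, _, h => ⟨h.1, Unblocked.of_append_left (p := b :: c :: p) h.2⟩

theorem Unblocked.append {a v : V} {r : List V} : ∀ {p : List V}, Unblocked E Z (p ++ [a, v]) →
    Unblocked E Z (a :: v :: r) → Unblocked E Z (p ++ a :: v :: r)
  | [], _, h => h
  | [_], h, h' => ⟨h.1, h'⟩
  | [_, _], h, h' => ⟨h.1, h.2.1, h'⟩
  | _ :: b :: c :: p, h, h' => ⟨h.1, Unblocked.append (p := b :: c :: p) h.2 h'⟩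

theorem Unblocked.not_blocked {l : List V} (h : Unblocked E Z l) : ¬ Blocked E Z l := by
  rintro ⟨a, m, b, ⟨s, t, rfl⟩, hb⟩
  rw [List.append_assoc] at h
  have ho : Open E Z a m b := (Unblocked.of_append_right h).1
  rcases hb with ⟨hc, hm⟩ | ⟨hc, hm⟩
  · exact ho.2 hc hm
  · obtain ⟨d, hd, hmd⟩ := ho.1 hc
    exact hm d hmd hd

/-- An unblocked walk that leaves `u` along an edge and comes back to its end against an edge
contains a collider below `u`. -/
theorem Unblocked.isAncestorOf (hE : ∀ v, ¬ Relation.TransGen E v v) {n v : V} (hnv : E v n) :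
    ∀ {l s : List V} {u w : V}, Unblocked E Z (u :: w :: l) →
      (u :: w :: l).IsChain (fun a b => E a b ∨ E b a) → u :: w :: l = s ++ [n, v] → E u w →
      IsAncestorOf E Z u := by
  intro l
  induction l with
  | nil =>
    intro s u w _ _ hs huw
    have : s = [] := by
      have := congrArg List.length hs
      simpa using this
    subst this
    simp only [List.nil_append, List.cons.injEq, and_true] at hs
    obtain ⟨rfl, rfl⟩ := hs
    exact absurd hnv (asymm_of_acyclic hE huw)
  | cons x l ih =>
    intro s u w hu hc hs huw
    obtain _ | ⟨u', s⟩ := s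
    · simp at hs
    simp only [List.cons_append, List.cons.injEq] at hs
    refine IsAncestorOf.of_edge ?_ huw
    rw [List.isChain_cons_cons] at hc
    have hc' := hc.2
    rw [List.isChain_cons_cons] at hc'
    by_cases hxw : E x w
    · exact hu.1.1 ⟨huw, hxw⟩
    · exact ih (s := s) hu.2 hc.2 hs.2 (hc'.1.resolve_right hxw)

/-- Here `n₁` and `n₂` are the first and last inner vertices of a loop at `v` that is cut out. If
`v` becomes a collider, it was one before unless both loop edges leave `v`, the case left to `h`. If
`v ∈ Z`, it was a collider at both visits, hence is one after the cut. -/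
theorem Open.of_loop {a v b n₁ n₂ : V} (h₁ : Open E Z a v n₁) (h₂ : Open E Z n₂ v b)
    (h : ¬ E n₁ v → ¬ E n₂ v → IsAncestorOf E Z v) : Open E Z a v b := by
  refine ⟨fun hc => ?_, fun hc hv => ?_⟩
  · by_cases hn₁ : E n₁ v
    · exact h₁.1 ⟨hc.1, hn₁⟩
    by_cases hn₂ : E n₂ v
    · exact h₂.1 ⟨hn₂, hc.2⟩
    exact h hn₁ hn₂
  · exact hc ⟨(not_imp_not.1 h₁.2 hv).1, (not_imp_not.1 h₂.2 hv).2⟩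

/-- A loop can be cut out of an unblocked walk. -/
theorem Unblocked.cut (hE : ∀ v, ¬ Relation.TransGen E v v) {p q r : List V} {v : V}
    (h : Unblocked E Z (p ++ v :: (q ++ v :: r)))
    (hc : (p ++ v :: (q ++ v :: r)).IsChain (fun a b => E a b ∨ E b a)) :
    Unblocked E Z (p ++ v :: r) := by
  have hr : Unblocked E Z (v :: r) := by
    rw [show p ++ v :: (q ++ v :: r) = (p ++ v :: q) ++ v :: r by simp] at h
    exact h.of_append_right
  obtain rfl | ⟨p, a, rfl⟩ := List.eq_nil_or_concat p
  · exact hr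
  rw [List.concat_eq_append] at h hc ⊢
  have hpa : Unblocked E Z (p ++ [a, v]) := by
    rw [show p ++ [a] ++ v :: (q ++ v :: r) = (p ++ [a, v]) ++ (q ++ v :: r) by simp] at h
    exact h.of_append_left
  rw [List.append_assoc]
  refine hpa.append ?_
  obtain _ | ⟨b, r⟩ := r
  · trivial
  refine ⟨?_, hr⟩
  have hloop : (v :: (q ++ [v])).IsChain (fun a b => E a b ∨ E b a) := by
    rw [show p ++ [a] ++ v :: (q ++ v :: b :: r) = (p ++ [a]) ++ ((v :: (q ++ [v])) ++ b :: r)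
      by simp] at hc
    exact (List.isChain_append.1 (List.isChain_append.1 hc).2.1).1
  have hul : Unblocked E Z (v :: (q ++ [v])) := by
    rw [show p ++ [a] ++ v :: (q ++ v :: b :: r) = (p ++ [a]) ++ ((v :: (q ++ [v])) ++ b :: r)
      by simp] at h
    exact h.of_append_right.of_append_left
  obtain _ | ⟨n₁, q⟩ := q
  · rw [List.nil_append, List.isChain_pair] at hloop
    exact absurd hloop (by simpa using irrefl_of_acyclic hE v)
  obtain ⟨s, n₂, hs⟩ : ∃ s n₂, n₁ :: q = s ++ [n₂] := by
    obtain h | ⟨s, n₂, h⟩ := List.eq_nil_or_concat (n₁ :: q)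
    · simp at h
    · exact ⟨s, n₂, by rw [h, List.concat_eq_append]⟩
  have h₁ : Open E Z a v n₁ := by
    rw [show p ++ [a] ++ v :: (n₁ :: q ++ v :: b :: r) = p ++ a :: v :: n₁ :: (q ++ v :: b :: r)
      by simp] at h
    exact h.of_append_right.1
  have h₂ : Open E Z n₂ v b := by
    rw [hs, show p ++ [a] ++ v :: (s ++ [n₂] ++ v :: b :: r) =
      (p ++ [a] ++ v :: s) ++ n₂ :: v :: b :: r by simp] at h
    exact h.of_append_right.1
  refine h₁.of_loop h₂ fun hn₁ hn₂ => ?_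
  have hvn₁ : E v n₁ := by
    rw [List.cons_append, List.isChain_cons_cons] at hloop
    exact hloop.1.resolve_right hn₁
  have hvn₂ : E v n₂ := by
    rw [hs, show v :: (s ++ [n₂] ++ [v]) = (v :: s) ++ [n₂, v] by simp] at hloop
    exact (List.isChain_pair.1 (List.isChain_append.1 hloop).2.1).resolve_left hn₂
  exact hul.isAncestorOf hE hvn₂ (s := v :: s) hloop (by
    simpa using congrArg (fun l => v :: (l ++ [v])) hs) hvn₁

/-- The endpoint `v` of an unblocked walk from `Y`; the flag tells whether the last edge of the
walk points to `v`. -/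
inductive ActiveTo (E : V → V → Prop) (Z : Set V) (Y : V) : Bool → V → Prop
  | start : ActiveTo E Z Y false Y
  | against {a b : V} (h : ActiveTo E Z Y false a) (ha : a ∉ Z) (hba : E b a) :
      ActiveTo E Z Y false b
  | along {s : Bool} {a b : V} (h : ActiveTo E Z Y s a) (ha : a ∉ Z) (hab : E a b) :
      ActiveTo E Z Y true b
  | collider {a b : V} (h : ActiveTo E Z Y true a) (ha : IsAncestorOf E Z a) (hba : E b a) :
      ActiveTo E Z Y false b

theorem ActiveTo.exists_walk (hE : ∀ v, ¬ Relation.TransGen E v v) {s : Bool} {v : V}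
    (h : ActiveTo E Z Y s v) : ∃ l, (v :: l).getLast? = some Y ∧
      (v :: l).IsChain (fun a b => E a b ∨ E b a) ∧ Unblocked E Z (v :: l) ∧
      ∀ a ∈ l.head?, if s then E a v else E v a := by
  induction h with
  | start => exact ⟨[], rfl, .singleton _, trivial, by simp⟩
  | @against a b _ ha hba ih =>
    obtain ⟨l, hY, hc, hu, hd⟩ := ih
    refine ⟨a :: l, hY, List.isChain_cons_cons.2 ⟨.inl hba, hc⟩, ?_, by simpa using hba⟩
    obtain _ | ⟨x, l⟩ := l
    · trivial
    · have : E a x := by simpa using hd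
      exact ⟨⟨fun h => absurd h.2 (asymm_of_acyclic hE this), fun _ => ha⟩, hu⟩
  | @along s a b _ ha hab ih =>
    obtain ⟨l, hY, hc, hu, hd⟩ := ih
    refine ⟨a :: l, hY, List.isChain_cons_cons.2 ⟨.inr hab, hc⟩, ?_, by simpa using hab⟩
    obtain _ | ⟨x, l⟩ := l
    · trivial
    · exact ⟨⟨fun h => absurd h.1 (asymm_of_acyclic hE hab), fun _ => ha⟩, hu⟩
  | @collider a b _ ha hba ih =>
    obtain ⟨l, hY, hc, hu, hd⟩ := ih
    refine ⟨a :: l, hY, List.isChain_cons_cons.2 ⟨.inl hba, hc⟩, ?_, by simpa using hba⟩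
    obtain _ | ⟨x, l⟩ := l
    · trivial
    · have : E x a := by simpa using hd
      exact ⟨⟨fun _ => ha, fun h => absurd ⟨hba, this⟩ h⟩, hu⟩

/-- Blocking is defined for paths, while active walks may revisit vertices. A shortest unblocked
walk is a path, since otherwise a loop could be cut out. -/
theorem ActiveTo.not_dSep (hE : ∀ v, ¬ Relation.TransGen E v v) {s : Bool}
    (h : ActiveTo E Z Y s X) : ¬ DSep E X Y Z := by
  intro hsep
  let p : List V → Prop := fun l => l.head? = some X ∧ l.getLast? = some Y ∧
    l.IsChain (fun a b => E a b ∨ E b a) ∧ Unblocked E Z l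
  have hne : ∃ n l, p l ∧ l.length = n := by
    obtain ⟨l, hY, hc, hu, -⟩ := h.exists_walk hE
    exact ⟨_, X :: l, ⟨rfl, hY, hc, hu⟩, rfl⟩
  classical
  obtain ⟨l, ⟨hX, hY, hc, hu⟩, hn⟩ := Nat.find_spec hne
  refine hu.not_blocked (hsep l ⟨hX, hY, ?_, hc⟩)
  by_contra hnd
  rw [List.nodup_iff_sublist] at hnd
  push Not at hnd
  obtain ⟨v, hv⟩ := hnd
  obtain ⟨r₁, r₂, rfl, h₁, h₂⟩ := List.cons_sublist_iff.1 hv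
  obtain ⟨p₁, q₁, rfl⟩ := List.append_of_mem h₁
  obtain ⟨q₂, r, rfl⟩ := List.append_of_mem (List.singleton_sublist.1 h₂)
  have e : p₁ ++ v :: q₁ ++ (q₂ ++ v :: r) = p₁ ++ v :: ((q₁ ++ q₂) ++ v :: r) := by simp
  rw [e] at hX hY hc hu hn
  refine Nat.find_min hne (m := (p₁ ++ v :: r).length) ?_
    ⟨p₁ ++ v :: r, ⟨?_, ?_, ?_, hu.cut hE hc⟩, rfl⟩
  · rw [← hn]; simp; omega
  · cases p₁ <;> simpa using hX
  · rw [← hY]; simp [List.getLast?_append, List.getLast?_cons]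
  · have h₁ := List.isChain_split.1 hc
    have h₂ := h₁.2
    rw [← List.cons_append] at h₂
    exact List.isChain_split.2 ⟨h₁.1, (List.isChain_split.1 h₂).2⟩

/-- A directed path that starts at a non-ancestor of `Z` never meets `Z`. -/
theorem ActiveTo.descend {s : Bool} {a t : V} (h : ActiveTo E Z Y s a)
    (ha : ¬ IsAncestorOf E Z a) (hat : Relation.ReflTransGen E a t) :
    ∃ s', ActiveTo E Z Y s' t := by
  induction hat with
  | refl => exact ⟨s, h⟩
  | @tail b c hab hbc ih =>
    obtain ⟨s', h'⟩ := ih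
    exact ⟨true, h'.along (fun hb => ha ⟨b, hb, hab⟩) hbc⟩

theorem ActiveTo.ascend {a : V} (ha : ¬ IsAncestorOf E Z a)
    (haY : Relation.ReflTransGen E a Y) : ActiveTo E Z Y false a := by
  induction haY using Relation.ReflTransGen.head_induction_on with
  | refl => exact .start
  | @head a c hac _ ih =>
    have hc : ¬ IsAncestorOf E Z c := fun h => ha (h.of_edge hac)
    exact (ih hc).against (fun h => hc (isAncestorOf_of_mem h)) hac

/-- The only obstacle is a collider at `a` that is no ancestor of `Z`. If `a` is an ancestor of `X`,
the walk can descend to `X`; if of `Y`, it is replaced by a directed path from `a` to `Y` traversed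
backwards, which makes `a` a non-collider. -/
theorem ActiveTo.extend_against {s : Bool} {a b : V} (h : ActiveTo E Z Y s a)
    (ha : a ∉ Z ∨ s = true) (hA : IsAncestorOf E (insert X (insert Y Z)) a) (hba : E b a) :
    (∃ s', ActiveTo E Z Y s' X) ∨ ∃ s', ActiveTo E Z Y s' b := by
  obtain _ | _ := s
  · exact .inr ⟨_, h.against (by simpa using ha) hba⟩
  · by_cases haZ : IsAncestorOf E Z a
    · exact .inr ⟨_, h.collider haZ hba⟩
    obtain ⟨d, rfl | rfl | hd, had⟩ := hA
    · exact .inl (h.descend haZ had)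
    · exact .inr ⟨_, (ActiveTo.ascend haZ had).against (fun h => haZ (isAncestorOf_of_mem h)) hba⟩
    · exact absurd ⟨d, hd, had⟩ haZ

/-- `a` and `b` lie outside `Z` and in a common family of the ancestral graph. -/
def MoralAdj (E : V → V → Prop) (X Y : V) (Z : Set V) (a b : V) : Prop :=
  a ∉ Z ∧ b ∉ Z ∧ ∃ v, IsAncestorOf E (insert X (insert Y Z)) v ∧ (a = v ∨ E a v) ∧ (b = v ∨ E b v)

theorem MoralAdj.isAncestorOf {a b : V} (h : MoralAdj E X Y Z a b) :
    IsAncestorOf E (insert X (insert Y Z)) b := by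
  obtain ⟨-, -, v, hv, -, rfl | hb⟩ := h
  · exact hv
  · exact hv.of_edge hb

/-- A moral adjacency is an edge or a passage through a common child. The walk either follows it or
gets diverted to `X`. -/
theorem exists_activeTo_of_moral {v : V} (h : Relation.ReflTransGen (MoralAdj E X Y Z) Y v) :
    (∃ s, ActiveTo E Z Y s X) ∨ ∃ s, ActiveTo E Z Y s v := by
  induction h with
  | refl => exact .inr ⟨_, .start⟩
  | @tail a b _ hab ih =>
    obtain ih | ⟨s, ih⟩ := ih
    · exact .inl ih
    obtain ⟨ha, hb, v, hv, rfl | hav, rfl | hbv⟩ := hab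
    · exact .inr ⟨s, ih⟩
    · exact ih.extend_against (.inl ha) hv hbv
    · exact .inr ⟨_, ih.along ha hav⟩
    · exact (ih.along ha hav).extend_against (.inr rfl) hv hbv

/-- A d-separating set splits the families of the ancestral graph into two sides. -/
theorem DSep.exists_partition (hE : ∀ v, ¬ Relation.TransGen E v v) (hsep : DSep E X Y Z)
    (hX : X ∉ Z) (hY : Y ∉ Z) :
    ∃ L R : Set V, X ∈ L ∧ Y ∈ R ∧ (∀ v ∈ L, v ∉ Z) ∧ (∀ v ∈ R, v ∉ Z) ∧ (∀ v ∈ L, v ∉ R) ∧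
      ∀ v ∈ L ∪ Z ∪ R, (v ∉ R ∧ ∀ a, E a v → a ∈ L ∪ Z) ∨ (v ∉ L ∧ ∀ a, E a v → a ∈ R ∪ Z) := by
  set A : Set V := {v | IsAncestorOf E (insert X (insert Y Z)) v} with hA
  set R : Set V := {v | Relation.ReflTransGen (MoralAdj E X Y Z) Y v} with hR
  have hRZ : ∀ v ∈ R, v ∉ Z := by
    intro v hv
    obtain rfl | ⟨_, _, h⟩ := Relation.ReflTransGen.cases_tail hv
    · exact hY
    · exact h.2.1
  have hRA : ∀ v ∈ R, v ∈ A := by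
    intro v hv
    obtain rfl | ⟨_, _, h⟩ := Relation.ReflTransGen.cases_tail hv
    · exact isAncestorOf_of_mem (by simp)
    · exact h.isAncestorOf
  have hXR : X ∉ R := by
    intro h
    obtain ⟨s, h⟩ := (exists_activeTo_of_moral h).elim id id
    exact h.not_dSep hE hsep
  -- `R` is the component of `Y` in the moral graph without `Z`, and `L` is the rest of the
  -- ancestral graph outside `Z`. A family is a moral clique: if it meets `R`, it lies in `R ∪ Z`,
  -- and otherwise in `L ∪ Z`.
  refine ⟨{v | v ∈ A ∧ v ∉ Z ∧ v ∉ R}, R, ⟨isAncestorOf_of_mem (by simp), hX, hXR⟩, .refl,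
    fun v hv => hv.2.1, hRZ, fun v hv => hv.2.2, fun v hv => ?_⟩
  have hvA : v ∈ A := by
    rcases hv with (hv | hv) | hv
    · exact hv.1
    · exact isAncestorOf_of_mem (by simp [hv])
    · exact hRA v hv
  by_cases h : ∃ b ∈ R, b = v ∨ E b v
  · obtain ⟨b, hbR, hb⟩ := h
    have hadj : ∀ a, (a = v ∨ E a v) → a ∉ Z → a ∈ R := fun a ha haZ =>
      Relation.ReflTransGen.tail hbR ⟨hRZ b hbR, haZ, v, hvA, hb, ha⟩
    refine .inr ⟨fun h => h.2.2 (hadj v (.inl rfl) h.2.1), fun a ha => ?_⟩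
    by_cases haZ : a ∈ Z
    · exact .inr haZ
    · exact .inl (hadj a (.inr ha) haZ)
  · push Not at h
    refine .inl ⟨fun hvR => (h v hvR).1 rfl, fun a ha => ?_⟩
    by_cases haZ : a ∈ Z
    · exact .inr haZ
    · exact .inl ⟨IsAncestorOf.of_edge hvA ha, haZ, fun haR => (h a haR).2 ha⟩

end DiGraph

/-! ### Coordinate σ-algebras and resampling in a product -/

namespace MeasureTheory

variable {V : Type uV} {D : V → Type uD} [∀ v, MeasurableSpace (D v)]

/-- The σ-algebra on the assignments that is generated by the coordinates in `S`. -/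
@[reducible]
def coordSigma (D : V → Type uD) [∀ v, MeasurableSpace (D v)] (S : Set V) :
    MeasurableSpace (∀ v, D v) :=
  sigmaOf (fun v => MeasurableSpace.comap (fun w : ∀ v, D v => w v) inferInstance) S

theorem coordSigma_le (S : Set V) : coordSigma D S ≤ MeasurableSpace.pi :=
  sigmaOf_le fun v _ => (measurable_pi_apply v).comap_le

theorem measurable_coord {S : Set V} {v : V} (hv : v ∈ S) :
    Measurable[coordSigma D S] (fun w : ∀ v, D v => w v) :=
  Measurable.of_comap_le (le_sigmaOf
    (m := fun v => MeasurableSpace.comap (fun w : ∀ v, D v => w v) inferInstance) hv)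

theorem measurable_coord_domRestrict {S T : Set V} (h : T ⊆ S) :
    Measurable[coordSigma D S] (T.domRestrict : (∀ v, D v) → ∀ v : T, D v) :=
  (@measurable_pi_iff _ _ _ (coordSigma D S) _ _).2 fun v => measurable_coord (h v.2)

theorem coordSigma_le_comap (S : Set V) :
    coordSigma D S ≤ MeasurableSpace.comap (S.domRestrict : (∀ v, D v) → ∀ v : S, D v)
      MeasurableSpace.pi := by
  refine sigmaOf_le fun v hv => ?_
  rintro _ ⟨F, hF, rfl⟩
  exact ⟨{p | p ⟨v, hv⟩ ∈ F}, measurable_pi_apply (⟨v, hv⟩ : S) hF, rfl⟩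

theorem mem_iff_of_coordSigma {S : Set V} {B : Set (∀ v, D v)}
    (hB : MeasurableSet[coordSigma D S] B) {w w' : ∀ v, D v} (h : ∀ v ∈ S, w v = w' v) : w ∈ B ↔ w' ∈ B := by
  obtain ⟨B', -, rfl⟩ := coordSigma_le_comap S B hB
  have : S.domRestrict w = S.domRestrict w' := funext fun v => h v v.2
  simp only [Set.mem_preimage, this]

theorem setLIntegral_congr_measure_of_trim {Ω : Type*} {m mΩ : MeasurableSpace Ω} (hm : m ≤ mΩ)
    {μ ν : Measure Ω} (h : ∀ A, MeasurableSet[m] A → μ A = ν A) {B : Set Ω}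
    (hB : MeasurableSet[m] B) {g : Ω → ENNReal} (hg : Measurable[m] g) :
    ∫⁻ x in B, g x ∂μ = ∫⁻ x in B, g x ∂ν := by
  have key : μ.trim hm = ν.trim hm := @Measure.ext _ m _ _ fun s hs => by
    rw [trim_measurableSet_eq hm hs, trim_measurableSet_eq hm hs, h s hs]
  rw [← lintegral_indicator (hm B hB), ← lintegral_indicator (hm B hB),
    ← lintegral_trim hm (hg.indicator hB), ← lintegral_trim hm (hg.indicator hB), key]

/-- Redrawing one coordinate independently preserves a product measure. This integrates out the
noise of one variable while its past stays fixed. -/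
theorem lintegral_pi_update {ι : Type*} [Fintype ι] [DecidableEq ι] {α : ι → Type*}
    [∀ i, MeasurableSpace (α i)] (μ : ∀ i, Measure (α i)) [∀ i, IsProbabilityMeasure (μ i)] (i : ι)
    {F : (∀ i, α i) → ENNReal} (hF : Measurable F) :
    ∫⁻ u, F u ∂Measure.pi μ = ∫⁻ u, ∫⁻ t, F (Function.update u i t) ∂μ i ∂Measure.pi μ := by
  have hne : Nonempty (∀ i, α i) := ⟨fun i => (nonempty_of_isProbabilityMeasure (μ i)).some⟩
  have hF' : Measurable fun u => ∫⁻ t, F (Function.update u i t) ∂μ i :=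
    (hF.comp measurable_update').lintegral_prod_right'
  rw [lintegral_eq_lmarginal_univ hne.some, lintegral_eq_lmarginal_univ hne.some,
    lmarginal_erase' F hF (Finset.mem_univ i), lmarginal_erase' _ hF' (Finset.mem_univ i)]
  simp

end MeasureTheory

/-! ### Local Markov properties of the two laws -/

namespace SCM

open DiGraph

variable {V : Type uV} {D : V → Type uD} [∀ v, MeasurableSpace (D v)] {G : LDAG V D}

/-- The conditional law of `v` given its parents. -/
noncomputable def mech (M : SCM.{uV, uD, uU} G) (v : V) (p : ∀ w : G.Pa v, D w) : Measure (D v) :=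
  (M.noise v).map (M.f v p)

theorem measurable_f_right (M : SCM.{uV, uD, uU} G) (v : V) (p : ∀ w : G.Pa v, D w) :
    Measurable (M.f v p) := (M.measurable_f v).comp measurable_prodMk_left

theorem mech_apply (M : SCM.{uV, uD, uU} G) {v : V} (p : ∀ w : G.Pa v, D w) {F : Set (D v)}
    (hF : MeasurableSet F) : M.mech v p F = M.noise v {t | M.f v p t ∈ F} :=
  Measure.map_apply (M.measurable_f_right v p) hF

theorem measurable_mech (M : SCM.{uV, uD, uU} G) {v : V} {F : Set (D v)} (hF : MeasurableSet F) :
    Measurable fun p => M.mech v p F := by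
  simp only [M.mech_apply _ hF]
  exact measurable_measure_prodMk_left (M.measurable_f v hF)

/-- In the context `c` the mechanism of `v` ignores the parents whose edge is absent. -/
theorem mech_eq_of_agreesOn [Finite V] (M : SCM.{uV, uD, uU} G) {c : PartialAssignment D}
    {r : ∀ v, D v} (hr : c.Agrees r) {v : V} {p : ∀ w : G.Pa v, D w} (hp : c.AgreesOn p)
    (q : ∀ w : G.Pa v, D w) (hq : ∀ w : G.Pa v, G.contextDAG c w v → q w = p w)
    (hq' : ∀ w : G.Pa v, ¬ G.contextDAG c w v → q w = r w) : M.mech v p = M.mech v q := by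
  classical
  -- Absent parents are overwritten by the values of `r` one at a time: the label that makes an edge
  -- ineffective may depend on the current values of the other parents.
  suffices ∀ s : Set (G.Pa v), (∀ w ∈ s, ¬ G.contextDAG c w v) →
      M.mech v p = M.mech v (fun w => if w ∈ s then r w else p w) by
    rw [this {w | ¬ G.contextDAG c w v} fun w hw => hw]
    congr 1
    funext w
    by_cases hw : G.contextDAG c w v
    · simp [hw, hq w hw]
    · simp [hw, hq' w hw]
  intro s
  induction s, s.toFinite using Set.Finite.induction_on with
  | empty => simp
  | @insert i s his _ ih =>
    intro hs
    rw [ih fun w hw => hs w (Set.mem_insert_of_mem i hw)]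
    set p₁ : ∀ w : G.Pa v, D w := fun w => if w ∈ s then r w else p w with hp₁
    have hag : c.AgreesOn p₁ := by
      intro w a hw
      by_cases h : w ∈ s
      · simp [hp₁, h, hr w a hw]
      · simp [hp₁, h, hp w a hw]
    have habs : G.AbsentIn c i v := by
      have := hs i (Set.mem_insert i s)
      by_contra h
      exact this ⟨i.2, h⟩
    obtain ⟨ℓ, hℓ, hℓag⟩ := habs (fun w => if h : w ∈ G.Pa v then p₁ ⟨w, h⟩ else r w) (by
      intro w a hw
      by_cases h : w ∈ G.Pa v
      · simpa [h] using hag ⟨w, h⟩ a hw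
      · simpa [h] using hr w a hw)
    refine M.local_csi i v ℓ hℓ _ _ (fun w a hw => ?_) fun w hw => ?_
    · simpa [w.2] using hℓag w a hw
    · have : w ≠ i := fun h => hw (by rw [h])
      simp [hp₁, this]

section solutions

variable [Finite V]

theorem sol_eq (M : SCM.{uV, uD, uU} G) (u : ∀ v, M.U v) (v : V) :
    M.sol u v = M.f v (fun w => M.sol u w) (u v) := G.solve_eq _ v

theorem measurable_sol (M : SCM.{uV, uD, uU} G) : Measurable M.sol := by
  refine measurable_pi_iff.2 fun v => ?_
  induction v using G.wellFounded_edge.induction with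
  | _ v ih =>
    simp only [M.sol_eq _ v]
    exact (M.measurable_f v).comp ((measurable_pi_iff.2 fun w : G.Pa v => ih w w.2).prodMk
      (measurable_pi_apply v))

variable [DecidableEq V]

theorem solDo_self (M : SCM.{uV, uD, uU} G) (X : V) (x : D X) (u : ∀ v, M.U v) :
    M.solDo X x u X = x := by
  rw [solDo, G.solve_eq, Function.update_self]

theorem solDo_of_ne (M : SCM.{uV, uD, uU} G) {X : V} (x : D X) (u : ∀ v, M.U v) {v : V}
    (hv : v ≠ X) : M.solDo X x u v = M.f v (fun w => M.solDo X x u w) (u v) := by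
  rw [solDo, G.solve_eq, Function.update_of_ne hv]

theorem measurable_solDo (M : SCM.{uV, uD, uU} G) (X : V) :
    Measurable fun q : (∀ v, M.U v) × D X => M.solDo X q.2 q.1 := by
  refine measurable_pi_iff.2 fun v => ?_
  induction v using G.wellFounded_edge.induction with
  | _ v ih =>
    by_cases hv : v = X
    · subst hv
      simp only [solDo_self]
      exact measurable_snd
    · simp only [M.solDo_of_ne _ _ hv]
      exact (M.measurable_f v).comp ((measurable_pi_iff.2 fun w : G.Pa v => ih w w.2).prodMk
        ((measurable_pi_apply v).comp measurable_fst))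

theorem sol_update (M : SCM.{uV, uD, uU} G) {S : Set V} (hS : IsAncestral G.edge S) {v : V}
    (hv : v ∉ S) (u : ∀ v, M.U v) (t : M.U v) {w : V} (hw : w ∈ S) :
    M.sol (Function.update u v t) w = M.sol u w := by
  induction w using G.wellFounded_edge.induction with
  | _ w ih =>
    rw [sol_eq, sol_eq, Function.update_of_ne (ne_of_mem_of_not_mem hw hv)]
    congr 1
    funext a
    exact ih a a.2 (hS w hw a a.2)

theorem solDo_update (M : SCM.{uV, uD, uU} G) {S : Set V} (hS : IsAncestral G.edge S) {v : V}
    (hv : v ∉ S) {X : V} (x : D X) (u : ∀ v, M.U v) (t : M.U v) {w : V} (hw : w ∈ S) :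
    M.solDo X x (Function.update u v t) w = M.solDo X x u w := by
  induction w using G.wellFounded_edge.induction with
  | _ w ih =>
    by_cases hX : w = X
    · subst hX
      rw [solDo_self, solDo_self]
    rw [solDo_of_ne _ _ _ hX, solDo_of_ne _ _ _ hX,
      Function.update_of_ne (ne_of_mem_of_not_mem hw hv)]
    congr 1
    funext a
    exact ih a a.2 (hS w hw a a.2)

theorem solDo_eq_sol (M : SCM.{uV, uD, uU} G) {S : Set V} (hS : IsAncestral G.edge S) {X : V}
    (hX : X ∉ S) (x : D X) (u : ∀ v, M.U v) {w : V} (hw : w ∈ S) :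
    M.solDo X x u w = M.sol u w := by
  induction w using G.wellFounded_edge.induction with
  | _ w ih =>
    rw [sol_eq, solDo_of_ne _ _ _ (ne_of_mem_of_not_mem hw hX)]
    congr 1
    funext a
    exact ih a a.2 (hS w hw a a.2)

end solutions

section laws

variable [Fintype V] [DecidableEq V]

instance (M : SCM.{uV, uD, uU} G) : IsProbabilityMeasure M.law :=
  Measure.isProbabilityMeasure_map M.measurable_sol.aemeasurable

/-- Redrawing the noise of `v` moves neither the variables in `S` nor the parents of `v`; it only
redraws `v` from its mechanism. -/
theorem law_localMarkov (M : SCM.{uV, uD, uU} G) {S : Set V} (hS : IsAncestral G.edge S) {v : V}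
    (hv : v ∉ S) (hpa : ∀ a, G.edge a v → a ∈ S) {F : Set (D v)} (hF : MeasurableSet F)
    {B : Set (∀ v, D v)} (hB : MeasurableSet[coordSigma D S] B) :
    M.law ({w | w v ∈ F} ∩ B) = ∫⁻ w in B, M.mech v (fun i => w i) F ∂M.law := by
  have hBm := coordSigma_le S B hB
  have hFm : MeasurableSet {w : ∀ v, D v | w v ∈ F} := measurable_pi_apply v hF
  have hsol := M.measurable_sol
  have hmech : Measurable fun w : ∀ v, D v => M.mech v (fun i => w i) F :=
    (M.measurable_mech hF).comp (measurable_pi_iff.2 fun i => measurable_pi_apply _)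
  rw [law, Measure.map_apply hsol (hFm.inter hBm), ← lintegral_indicator hBm,
    lintegral_map (hmech.indicator hBm) hsol, ← lintegral_indicator_one (hsol (hFm.inter hBm)),
    lintegral_pi_update _ v (measurable_one.indicator (hsol (hFm.inter hBm)))]
  refine lintegral_congr fun u => ?_
  have hmem : ∀ t, (M.sol (Function.update u v t) ∈ B ↔ M.sol u ∈ B) := fun t =>
    mem_iff_of_coordSigma hB fun w hw => M.sol_update hS hv u t hw
  have hval : ∀ t, M.sol (Function.update u v t) v = M.f v (fun i => M.sol u i) t := fun t => by
    rw [sol_eq, Function.update_self]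
    congr 1
    funext a
    exact M.sol_update hS hv u t (hpa a a.2)
  by_cases hu : M.sol u ∈ B
  · have hm : MeasurableSet {t | M.f v (fun i => M.sol u i) t ∈ F} :=
      M.measurable_f_right v _ hF
    rw [Set.indicator_of_mem hu, mech_apply _ _ hF, ← lintegral_indicator_one hm]
    refine lintegral_congr fun t => ?_
    have ht : Function.update u v t ∈ M.sol ⁻¹' ({w | w v ∈ F} ∩ B) ↔
        t ∈ {t | M.f v (fun i => M.sol u i) t ∈ F} := by
      rw [Set.mem_preimage, Set.mem_inter_iff, Set.mem_ofPred_eq, hval, hmem, Set.mem_ofPred_eq]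
      exact and_iff_left hu
    exact Set.indicator_eq_indicator ht rfl
  · simp [Set.indicator, hmem, hu]

variable {X : V} {P : Set V}

omit [DecidableEq V] in
theorem measurable_lawDo_kernel (M : SCM.{uV, uD, uU} G) (π : Kernel (∀ v : P, D v) (D X))
    [IsMarkovKernel π] {B : Set ((∀ v, M.U v) × D X)} (hB : MeasurableSet B) :
    Measurable fun u => π (P.domRestrict (M.sol u)) {x | (u, x) ∈ B} := by
  have h : Measurable fun u => P.domRestrict (M.sol u) :=
    measurable_pi_iff.2 fun v => (measurable_pi_apply _).comp M.measurable_sol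
  exact Kernel.measurable_kernel_prodMk_left (κ := π.comap _ h) hB

theorem measurable_lawDo (M : SCM.{uV, uD, uU} G) (π : Kernel (∀ v : P, D v) (D X))
    [IsMarkovKernel π] :
    Measurable fun u => (π (P.domRestrict (M.sol u))).map (fun x => M.solDo X x u) := by
  refine Measure.measurable_of_measurable_coe _ fun B hB => ?_
  have h : ∀ u, Measurable fun x => M.solDo X x u := fun u =>
    (M.measurable_solDo X).comp measurable_prodMk_left
  simp only [Measure.map_apply (h _) hB]
  exact M.measurable_lawDo_kernel π (M.measurable_solDo X hB)

theorem lawDo_apply (M : SCM.{uV, uD, uU} G) (π : Kernel (∀ v : P, D v) (D X))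
    [IsMarkovKernel π] {B : Set (∀ v, D v)} (hB : MeasurableSet B) :
    M.lawDo X P π B =
      ∫⁻ u, π (P.domRestrict (M.sol u)) {x | M.solDo X x u ∈ B} ∂Measure.pi M.noise := by
  have h : ∀ u, Measurable fun x => M.solDo X x u := fun u =>
    (M.measurable_solDo X).comp measurable_prodMk_left
  rw [lawDo, Measure.bind_apply hB (M.measurable_lawDo π).aemeasurable]
  simp only [Measure.map_apply (h _) hB]
  rfl

theorem lintegral_lawDo (M : SCM.{uV, uD, uU} G) (π : Kernel (∀ v : P, D v) (D X))
    [IsMarkovKernel π] {g : (∀ v, D v) → ENNReal} (hg : Measurable g) :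
    ∫⁻ w, g w ∂M.lawDo X P π =
      ∫⁻ u, ∫⁻ x, g (M.solDo X x u) ∂π (P.domRestrict (M.sol u)) ∂Measure.pi M.noise := by
  have h : ∀ u, Measurable fun x => M.solDo X x u := fun u =>
    (M.measurable_solDo X).comp measurable_prodMk_left
  rw [lawDo, Measure.lintegral_bind (M.measurable_lawDo π).aemeasurable hg.aemeasurable]
  simp only [lintegral_map hg (h _)]

instance (M : SCM.{uV, uD, uU} G) (π : Kernel (∀ v : P, D v) (D X)) [IsMarkovKernel π] :
    IsProbabilityMeasure (M.lawDo X P π) :=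
  ⟨by simp [M.lawDo_apply π MeasurableSet.univ]⟩

/-- The intervention does not change the law of the non-descendants of `X`. -/
theorem lawDo_eq_law (M : SCM.{uV, uD, uU} G) (π : Kernel (∀ v : P, D v) (D X))
    [IsMarkovKernel π] {S : Set V} (hS : IsAncestral G.edge S) (hX : X ∉ S) {B : Set (∀ v, D v)}
    (hB : MeasurableSet[coordSigma D S] B) : M.lawDo X P π B = M.law B := by
  have hBm := coordSigma_le S B hB
  rw [M.lawDo_apply π hBm, law, Measure.map_apply M.measurable_sol hBm,
    ← lintegral_indicator_one (M.measurable_sol hBm)]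
  refine lintegral_congr fun u => ?_
  have hmem : ∀ x, (M.solDo X x u ∈ B ↔ M.sol u ∈ B) := fun x =>
    mem_iff_of_coordSigma hB fun w hw => M.solDo_eq_sol hS hX x u hw
  by_cases hu : M.sol u ∈ B <;> simp [hmem, hu]

/-- The variables in `S` keep their observational values whatever action is drawn, so given this
past the action has law `π`. -/
theorem lawDo_localMarkov_self (M : SCM.{uV, uD, uU} G) (π : Kernel (∀ v : P, D v) (D X))
    [IsMarkovKernel π] {S : Set V} (hS : IsAncestral G.edge S) (hX : X ∉ S) (hP : P ⊆ S)
    {F : Set (D X)} (hF : MeasurableSet F) {B : Set (∀ v, D v)}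
    (hB : MeasurableSet[coordSigma D S] B) :
    M.lawDo X P π ({w | w X ∈ F} ∩ B) = ∫⁻ w in B, π (P.domRestrict w) F ∂M.lawDo X P π := by
  have hBm := coordSigma_le S B hB
  have hFm : MeasurableSet {w : ∀ v, D v | w X ∈ F} := measurable_pi_apply X hF
  have hπ : Measurable[coordSigma D S] fun w : ∀ v, D v => π (P.domRestrict w) F :=
    (Kernel.measurable_coe π hF).comp (measurable_coord_domRestrict hP)
  rw [setLIntegral_congr_measure_of_trim (coordSigma_le S)
    (fun A hA => M.lawDo_eq_law π hS hX hA) hB hπ, M.lawDo_apply π (hFm.inter hBm), law,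
    ← lintegral_indicator hBm,
    lintegral_map ((hπ.mono (coordSigma_le S) le_rfl).indicator hBm) M.measurable_sol]
  refine lintegral_congr fun u => ?_
  have hmem : ∀ x, (M.solDo X x u ∈ B ↔ M.sol u ∈ B) := fun x =>
    mem_iff_of_coordSigma hB fun w hw => M.solDo_eq_sol hS hX x u hw
  by_cases hu : M.sol u ∈ B <;> simp [hmem, hu, solDo_self]

/-- If the action is in the past, so are the policy inputs; the draw of the action then does not
involve the noise of `v`, and Fubini exchanges the two. If it is not, `insert v S` is an ancestral
set without `X`, on which the intervention changes nothing. -/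
theorem lawDo_localMarkov_of_ne (M : SCM.{uV, uD, uU} G) (π : Kernel (∀ v : P, D v) (D X))
    [IsMarkovKernel π] {S : Set V} (hS : IsAncestral (addParents G.edge P X) S) {v : V}
    (hvX : v ≠ X) (hv : v ∉ S) (hpa : ∀ a, G.edge a v → a ∈ S) {F : Set (D v)}
    (hF : MeasurableSet F) {B : Set (∀ v, D v)} (hB : MeasurableSet[coordSigma D S] B) :
    M.lawDo X P π ({w | w v ∈ F} ∩ B) =
      ∫⁻ w in B, M.mech v (fun i => w i) F ∂M.lawDo X P π := by
  have hBm := coordSigma_le S B hB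
  have hS' : IsAncestral G.edge S := hS.mono fun _ _ h => .inl h
  by_cases hX : X ∈ S
  · have hP : P ⊆ S := fun a ha => hS X hX a (.inr ⟨ha, rfl⟩)
    have hFm : MeasurableSet {w : ∀ v, D v | w v ∈ F} := measurable_pi_apply v hF
    have hmech : Measurable fun w : ∀ v, D v => M.mech v (fun i => w i) F :=
      (M.measurable_mech hF).comp (measurable_pi_iff.2 fun i => measurable_pi_apply _)
    have hker : Measurable fun u => π (P.domRestrict (M.sol u))
        {x | M.solDo X x u ∈ {w | w v ∈ F} ∩ B} :=
      M.measurable_lawDo_kernel π (M.measurable_solDo X (hFm.inter hBm))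
    rw [M.lawDo_apply π (hFm.inter hBm), ← lintegral_indicator hBm,
      M.lintegral_lawDo π (hmech.indicator hBm), lintegral_pi_update _ v hker]
    refine lintegral_congr fun u => ?_
    have hmem : ∀ t x, (M.solDo X x (Function.update u v t) ∈ B ↔ M.solDo X x u ∈ B) :=
      fun t x => mem_iff_of_coordSigma hB fun w hw => M.solDo_update hS' hv x u t hw
    have hval : ∀ t x, M.solDo X x (Function.update u v t) v =
        M.f v (fun i => M.solDo X x u i) t := fun t x => by
      rw [solDo_of_ne _ _ _ hvX, Function.update_self]
      congr 1
      funext a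
      exact M.solDo_update hS' hv x u t (hpa a a.2)
    have hsolP : ∀ t, P.domRestrict (M.sol (Function.update u v t)) = P.domRestrict (M.sol u) :=
      fun t => funext fun a => M.sol_update hS' hv u t (hP a.2)
    have hdo : Measurable fun x => M.solDo X x u :=
      (M.measurable_solDo X).comp measurable_prodMk_left
    set C : Set (D X × M.U v) :=
      {q | M.f v (fun i => M.solDo X q.1 u i) q.2 ∈ F ∧ M.solDo X q.1 u ∈ B}
    have hC : MeasurableSet C := by
      refine MeasurableSet.inter ((M.measurable_f v).comp (Measurable.prodMk
        (measurable_pi_iff.2 fun i => ?_) measurable_snd) hF) ((hdo.comp measurable_fst) hBm)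
      exact (measurable_pi_apply _).comp (hdo.comp measurable_fst)
    calc _ = ∫⁻ t, π (P.domRestrict (M.sol u)) ((fun x => (x, t)) ⁻¹' C) ∂M.noise v := by
          refine lintegral_congr fun t => ?_
          rw [hsolP]
          congr 1
          ext x
          simp [C, hmem, hval]
      _ = ∫⁻ x, M.noise v (Prod.mk x ⁻¹' C) ∂π (P.domRestrict (M.sol u)) := by
          rw [← Measure.prod_apply hC, ← Measure.prod_apply_symm hC]
      _ = _ := by
          refine lintegral_congr fun x => ?_
          by_cases hx : M.solDo X x u ∈ B
          · simp [C, hx, mech_apply _ _ hF]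
          · simp [C, hx]
  · have hT : IsAncestral G.edge (insert v S) := by
      rintro b (rfl | hb) a hab
      · exact .inr (hpa a hab)
      · exact .inr (hS' b hb a hab)
    have hXT : X ∉ insert v S := by simp [hX, hvX.symm]
    have hBT : MeasurableSet[coordSigma D (insert v S)] B :=
      sigmaOf_mono (Set.subset_insert v S) B hB
    have hmech : Measurable[coordSigma D (insert v S)]
        fun w : ∀ v, D v => M.mech v (fun i => w i) F :=
      (M.measurable_mech hF).comp
        (measurable_coord_domRestrict (T := G.Pa v) fun a ha => .inr (hpa a ha))
    have hFT : MeasurableSet[coordSigma D (insert v S)] ({w | w v ∈ F} ∩ B) :=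
      MeasurableSet.inter (measurable_coord (Set.mem_insert v S) hF) hBT
    rw [M.lawDo_eq_law π hT hXT hFT,
      M.law_localMarkov hS' hv hpa hF hB]
    exact (setLIntegral_congr_measure_of_trim (coordSigma_le _)
      (fun A hA => M.lawDo_eq_law π hT hXT hA) hBT hmech).symm

end laws

end SCM

/-! ### The graph with policy edges -/

namespace DiGraph

/-- A path through new edges is cut before the first and after the last of them. -/
theorem reflTransGen_addParents {V : Type*} {E : V → V → Prop} {P : Set V} {X a b : V}
    (h : Relation.ReflTransGen (addParents E P X) a b) :
    Relation.ReflTransGen E a b ∨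
      (Relation.ReflTransGen E X b ∧ ∃ p ∈ P, Relation.ReflTransGen E a p) := by
  induction h with
  | refl => exact .inl .refl
  | @tail b c _ hbc ih =>
    obtain hbc | ⟨hb, rfl⟩ := hbc
    · exact ih.imp (·.tail hbc) (And.imp_left (·.tail hbc))
    · exact .inr ⟨.refl, ih.elim (fun h => ⟨b, hb, h⟩) And.right⟩

theorem acyclic_addParents {V : Type*} {E : V → V → Prop} (hE : ∀ v, ¬ Relation.TransGen E v v)
    {P : Set V} {X : V} (hP : ∀ v ∈ P, ¬ Relation.ReflTransGen E X v) (v : V) :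
    ¬ Relation.TransGen (addParents E P X) v v := by
  intro h
  obtain ⟨c, hvc, hcv⟩ := Relation.TransGen.head'_iff.1 h
  obtain hvc | ⟨hv, rfl⟩ := hvc
  · obtain hcv | ⟨hXv, p, hp, hcp⟩ := reflTransGen_addParents hcv
    · exact hE v (.head' hvc hcv)
    · exact hP p hp ((hXv.tail hvc).trans hcp)
  · obtain hcv | ⟨-, p, hp, hcp⟩ := reflTransGen_addParents hcv
    · exact hP v hv hcv
    · exact hP p hp hcp

end DiGraph

/-! ### Two regimes on one space -/

namespace MeasureTheory

variable {V : Type uV} {D : V → Type uD} [∀ v, MeasurableSpace (D v)]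

/-- The σ-algebra that the coordinates in `S` generate on the product with a regime indicator. -/
@[reducible]
def regimeSigma (D : V → Type uD) [∀ v, MeasurableSpace (D v)] (S : Set V) :
    MeasurableSpace (Bool × ∀ v, D v) :=
  sigmaOf (fun v => MeasurableSpace.comap (fun ω : Bool × ∀ v, D v => ω.2 v) inferInstance) S

theorem regimeSigma_eq_comap (S : Set V) :
    regimeSigma D S = MeasurableSpace.comap Prod.snd (coordSigma D S) := by
  simp only [regimeSigma, coordSigma, sigmaOf, MeasurableSpace.comap_iSup,
    MeasurableSpace.comap_comp]
  rfl

theorem measurable_comp_snd {S : Set V} {β : Type*} [MeasurableSpace β] {g : (∀ v, D v) → β}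
    (hg : Measurable[coordSigma D S] g) : Measurable[regimeSigma D S] fun ω => g ω.2 := by
  rw [regimeSigma_eq_comap]
  exact hg.comp (Measurable.of_comap_le le_rfl)

theorem measurableSet_regime_section {S : Set V} {B : Set (Bool × ∀ v, D v)}
    (hB : MeasurableSet[MeasurableSpace.comap Prod.fst ⊤ ⊔ regimeSigma D S] B) (s : Bool) :
    MeasurableSet[coordSigma D S] (Prod.mk s ⁻¹' B) := by
  have : MeasurableSpace.comap Prod.fst ⊤ ⊔ regimeSigma D S ≤
      MeasurableSpace.map (Prod.mk s) (coordSigma D S) := by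
    rw [regimeSigma_eq_comap]
    refine sup_le ?_ ?_
    · rintro _ ⟨F, -, rfl⟩
      change MeasurableSet[coordSigma D S] {w : ∀ v, D v | s ∈ F}
      exact @MeasurableSet.const _ (coordSigma D S) _
    · rintro _ ⟨F, hF, rfl⟩
      exact hF
  exact this B hB

/-- The measure with the component `ρ s` in the regime `s`. -/
noncomputable def regimeMeasure (ρ : Bool → Measure (∀ v, D v)) : Measure (Bool × ∀ v, D v) :=
  ∑ s, (ρ s).map (Prod.mk s)

variable {ρ : Bool → Measure (∀ v, D v)}

theorem regimeMeasure_apply {B : Set (Bool × ∀ v, D v)} (hB : MeasurableSet B) :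
    regimeMeasure ρ B = ∑ s, ρ s (Prod.mk s ⁻¹' B) := by
  simp only [regimeMeasure, Measure.finsetSum_apply, Measure.map_apply measurable_prodMk_left hB]

theorem setLIntegral_regimeMeasure {B : Set (Bool × ∀ v, D v)} (hB : MeasurableSet B)
    {g : (Bool × ∀ v, D v) → ENNReal} (hg : Measurable g) :
    ∫⁻ ω in B, g ω ∂regimeMeasure ρ = ∑ s, ∫⁻ w in Prod.mk s ⁻¹' B, g (s, w) ∂ρ s := by
  rw [← lintegral_indicator hB, regimeMeasure, lintegral_finsetSum_measure]
  refine Finset.sum_congr rfl fun s _ => ?_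
  rw [lintegral_map (hg.indicator hB) measurable_prodMk_left,
    ← lintegral_indicator (measurable_prodMk_left hB)]
  rfl

instance [∀ s, IsFiniteMeasure (ρ s)] : IsFiniteMeasure (regimeMeasure ρ) :=
  ⟨by rw [regimeMeasure_apply MeasurableSet.univ]; simp⟩

end MeasureTheory

/-! ### Measurability of contexts -/

namespace PartialAssignment

variable {V : Type uV} {D : V → Type uD} [∀ v, MeasurableSpace (D v)]

theorem measurableSet_agrees_at (c : PartialAssignment D)
    (hc : ∀ v ∈ c.dom, MeasurableSingletonClass (D v)) (v : V) :
    MeasurableSet {x : D v | ∀ a, c v = some a → x = a} := by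
  cases h : c v with
  | none => simp
  | some a =>
    have := hc v (by simp [dom, h])
    simp

theorem measurableSet_agreesOn [Finite V] (c : PartialAssignment D)
    (hc : ∀ v ∈ c.dom, MeasurableSingletonClass (D v)) {T S : Set V} (hT : T ⊆ S) :
    MeasurableSet[coordSigma D S] {w | ∀ v ∈ T, ∀ a, c v = some a → w v = a} := by
  have : {w : ∀ v, D v | ∀ v ∈ T, ∀ a, c v = some a → w v = a} =
      ⋂ v ∈ T, (fun w => w v) ⁻¹' {x : D v | ∀ a, c v = some a → x = a} := by
    ext; simp
  rw [this]
  exact MeasurableSet.biInter T.to_countable fun v hv =>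
    measurable_coord (hT hv) (c.measurableSet_agrees_at hc v)

theorem measurableSet_agrees [Finite V] (c : PartialAssignment D)
    (hc : ∀ v ∈ c.dom, MeasurableSingletonClass (D v)) {S : Set V} (hS : c.dom ⊆ S) :
    MeasurableSet[coordSigma D S] {w | c.Agrees w} := by
  convert c.measurableSet_agreesOn hc hS using 1
  ext w
  exact ⟨fun h v _ => h v, fun h v a hv => h v (by simp [dom, hv]) a hv⟩

end PartialAssignment

/-! ### Transfer between the regimes through a separator -/

namespace SCM

open DiGraph

variable {V : Type uV} [Fintype V] [DecidableEq V] {D : V → Type uD} [∀ v, MeasurableSpace (D v)]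
  {G : LDAG V D}

/-- If, in the context `c`, the set `Z` separates the variables in `R` from the change of regime,
then the observational and the interventional law agree on `R` as soon as they agree on `Z`. -/
theorem law_eq_lawDo_of_partition (M : SCM.{uV, uD, uU} G) {X : V} {P : Set V}
    (hP : ∀ v ∈ P, ¬ Relation.ReflTransGen G.edge X v) (π : Kernel (∀ v : P, D v) (D X))
    [IsMarkovKernel π] {c : PartialAssignment D}
    (hc : ∀ v ∈ c.dom, MeasurableSingletonClass (D v)) {L Z R : Set V} (hcZ : c.dom ⊆ Z)
    (hXR : X ∉ R)
    (hfam : ∀ v ∈ L ∪ Z ∪ R, v ≠ X → (v ∉ R ∧ ∀ a, G.contextDAG c a v → a ∈ L ∪ Z) ∨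
      (v ∉ L ∧ ∀ a, G.contextDAG c a v → a ∈ R ∪ Z))
    (hX : ∀ a, G.contextDAG c a X → a ∈ L ∪ Z)
    (hπ : ∀ F, MeasurableSet F →
      Measurable[coordSigma D ((L ∪ Z) ∩ P)] fun w => π (P.domRestrict w) F)
    (hZ : ∀ A, MeasurableSet[coordSigma D Z] A →
      M.law (A ∩ {w | c.Agrees w}) = M.lawDo X P π (A ∩ {w | c.Agrees w}))
    {B : Set (∀ v, D v)} (hB : MeasurableSet[coordSigma D (R ∪ Z)] B) :
    M.law (B ∩ {w | c.Agrees w}) = M.lawDo X P π (B ∩ {w | c.Agrees w}) := by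
  classical
  -- A completion `r` of the context supplies dummy values for absent parents; without one, both
  -- masses are zero.
  by_cases hr : ∃ r, c.Agrees r
  swap
  · have : {w | c.Agrees w} = ∅ := Set.eq_empty_of_forall_notMem fun w hw => hr ⟨w, hw⟩
    simp [this]
  obtain ⟨r, hr⟩ := hr
  set ρ : Bool → Measure (∀ v, D v) := fun s => bif s then M.lawDo X P π else M.law with hρ
  have hfin : ∀ s, IsFiniteMeasure (ρ s) := by
    rintro (_ | _)
    · exact inferInstanceAs (IsFiniteMeasure M.law)
    · exact inferInstanceAs (IsFiniteMeasure (M.lawDo X P π))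
  have hacyc := acyclic_addParents G.acyclic hP
  -- `q v w` reads `w` only at the parents of `v` in the context-specific DAG, so that `M.mech v (q
  -- v w)` has the measurability that the partition demands.
  set q : ∀ v : V, (∀ v, D v) → ∀ w : G.Pa v, D w :=
    fun v w i => if G.contextDAG c i v then w i else r i with hq
  have hqm : ∀ (v : V) (T : Set V), (∀ a, G.contextDAG c a v → a ∈ T) →
      Measurable[coordSigma D T] (q v) := by
    intro v T hT
    refine (@measurable_pi_iff _ _ _ (coordSigma D T) _ _).2 fun i => ?_
    by_cases hi : G.contextDAG c i v
    · simpa [hq, hi] using measurable_coord (D := D) (hT i hi)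
    · simp [hq, hi]
  have hmech : ∀ (v : V) (S : Set V), (∀ a, G.edge a v → a ∈ S) → ∀ w : ∀ v, D v,
      (∀ v ∈ S, ∀ a, c v = some a → w v = a) → M.mech v (fun i => w i) = M.mech v (q v w) := by
    intro v S hpa w hw
    refine M.mech_eq_of_agreesOn hr (fun i a hi => hw i (hpa i i.2) a hi) _ (fun i hi => ?_)
      fun i hi => ?_ <;> simp [hq, hi]
  have hctx : ∀ v, MeasurableSet[MeasurableSpace.comap (fun ω : Bool × ∀ v, D v => ω.2 v)
      inferInstance] {ω : Bool × ∀ v, D v | ∀ a, c v = some a → ω.2 v = a} := fun v =>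
    ⟨_, c.measurableSet_agrees_at hc v, rfl⟩
  have hle : ∀ S, regimeSigma D S ≤ Prod.instMeasurableSpace := fun S => sigmaOf_le fun v _ =>
    ((measurable_pi_apply v).comp measurable_snd).comap_le
  have hle₀ : MeasurableSpace.comap (Prod.fst : Bool × (∀ v, D v) → Bool) ⊤ ≤
    Prod.instMeasurableSpace := measurable_fst.comap_le
  -- A kernel identity on the joint space may be checked in each regime separately, on past events
  -- inside the revealed part of the context.
  have hker : ∀ (v : V) (S : Set V) (F : Set (D v)), MeasurableSet F →
      ∀ k : (Bool × ∀ v, D v) → ENNReal, Measurable k →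
      (∀ s C, MeasurableSet[coordSigma D S] C →
        (∀ w ∈ C, ∀ v ∈ S, ∀ a, c v = some a → w v = a) →
        ρ s ({w | w v ∈ F} ∩ C) = ∫⁻ w in C, k (s, w) ∂ρ s) →
      ∀ C, MeasurableSet[MeasurableSpace.comap Prod.fst ⊤ ⊔ regimeSigma D S] C →
        (regimeMeasure ρ).restrict
          (⋂ v ∈ S, {ω : Bool × ∀ v, D v | ∀ a, c v = some a → ω.2 v = a})
          ((fun ω : Bool × ∀ v, D v => ω.2 v) ⁻¹' F ∩ C) =
        ∫⁻ ω in C, k ω ∂(regimeMeasure ρ).restrict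
          (⋂ v ∈ S, {ω : Bool × ∀ v, D v | ∀ a, c v = some a → ω.2 v = a}) := by
    intro v S F hF k hk h C hC
    set T : Set (Bool × ∀ v, D v) := ⋂ v ∈ S, {ω | ∀ a, c v = some a → ω.2 v = a} with hT
    have hTm : MeasurableSet[regimeSigma D S] T :=
      MeasurableSet.biInter S.to_countable fun v hv => le_sigmaOf (m := fun v =>
        MeasurableSpace.comap (fun ω : Bool × ∀ v, D v => ω.2 v) inferInstance) hv _ (hctx v)
    have hCT : MeasurableSet[MeasurableSpace.comap Prod.fst ⊤ ⊔ regimeSigma D S] (C ∩ T) :=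
      MeasurableSet.inter hC
        (le_sup_right (a := MeasurableSpace.comap Prod.fst ⊤) (b := regimeSigma D S) T hTm)
    have hCm := sup_le hle₀ (hle S) C hC
    have hCTm := sup_le hle₀ (hle S) _ hCT
    have hFm : MeasurableSet ((fun ω : Bool × ∀ v, D v => ω.2 v) ⁻¹' F) :=
      ((measurable_pi_apply v).comp measurable_snd) hF
    rw [Measure.restrict_apply (hFm.inter hCm), Measure.restrict_restrict hCm, Set.inter_assoc,
      regimeMeasure_apply (hFm.inter hCTm), setLIntegral_regimeMeasure hCTm hk]
    refine Finset.sum_congr rfl fun s _ => ?_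
    refine h s _ (measurableSet_regime_section hCT s) fun w hw v hv => ?_
    have := hw.2
    simp only [hT, Set.mem_iInter] at this
    exact this v hv
  have hCI := isCondIndep_of_localMarkov (E := addParents G.edge P X) hacyc
    (m := fun v => MeasurableSpace.comap (fun ω : Bool × ∀ v, D v => ω.2 v) inferInstance)
    (fun v => ((measurable_pi_apply v).comp measurable_snd).comap_le) hle₀ hctx
    (L := L) (Z := Z) (R := R) (fun v hv => by
      have : c v = none := by
        by_contra h
        exact hv (hcZ h)
      simp [this]) (μ := regimeMeasure ρ) (fun v hv S hS hvS hpa => by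
    have hS' : IsAncestral G.edge S := hS.mono fun _ _ h => .inl h
    have hpa' : ∀ a, G.edge a v → a ∈ S := fun a h => hpa a (.inl h)
    have hcpa : ∀ a, G.contextDAG c a v → a ∈ S := fun a h => hpa' a h.1
    by_cases hvX : v = X
    · subst hvX
      have hPS : P ⊆ S := fun a ha => hpa a (.inr ⟨ha, rfl⟩)
      refine .inl ⟨hXR, ?_⟩
      rintro _ ⟨F, hF, rfl⟩
      -- The kernel of the action is the only one that sees the regime, which is why the indicator
      -- is placed on the side of `L`.
      have hk : Measurable[MeasurableSpace.comap Prod.fst ⊤ ⊔ regimeSigma D ((L ∪ Z) ∩ S)]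
          fun ω : Bool × ∀ v, D v => if ω.1 = true then π (P.domRestrict ω.2) F
            else M.mech v (q v ω.2) F := by
        refine Measurable.ite ?_ ?_ ?_
        · exact le_sup_left (a := MeasurableSpace.comap Prod.fst ⊤)
            (b := regimeSigma D ((L ∪ Z) ∩ S)) _ ⟨{true}, trivial, rfl⟩
        · exact (measurable_comp_snd (hπ F hF)).mono
            ((sigmaOf_mono (Set.inter_subset_inter_right _ hPS)).trans le_sup_right) le_rfl
        · exact (measurable_comp_snd ((M.measurable_mech hF).comp
            (hqm v ((L ∪ Z) ∩ S) fun a ha => ⟨hX a ha, hcpa a ha⟩))).mono le_sup_right le_rfl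
      refine ⟨_, hk, hker v S F hF _ (hk.mono (sup_le hle₀ (hle _)) le_rfl) fun s C hC hCc => ?_⟩
      obtain _ | _ := s
      · refine (M.law_localMarkov hS' hvS hpa' hF hC).trans ?_
        refine setLIntegral_congr_fun (coordSigma_le S C hC) fun w hw => ?_
        simp [hmech v S hpa' w (hCc w hw)]
      · refine (M.lawDo_localMarkov_self π hS' hvS hPS hF hC).trans ?_
        simp [hρ]
    · have hspec : ∀ T : Set V, (∀ a, G.contextDAG c a v → a ∈ T) → ∀ F : Set (D v),
          MeasurableSet F → ∃ k : (Bool × ∀ v, D v) → ENNReal,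
            Measurable[regimeSigma D (T ∩ S)] k ∧
            ∀ C, MeasurableSet[MeasurableSpace.comap Prod.fst ⊤ ⊔ regimeSigma D S] C →
              (regimeMeasure ρ).restrict
                (⋂ v ∈ S, {ω : Bool × ∀ v, D v | ∀ a, c v = some a → ω.2 v = a})
                ((fun ω : Bool × ∀ v, D v => ω.2 v) ⁻¹' F ∩ C) =
              ∫⁻ ω in C, k ω ∂(regimeMeasure ρ).restrict
                (⋂ v ∈ S, {ω : Bool × ∀ v, D v | ∀ a, c v = some a → ω.2 v = a}) := by
        intro T hT F hF
        have hk : Measurable[regimeSigma D (T ∩ S)]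
            fun ω : Bool × ∀ v, D v => M.mech v (q v ω.2) F :=
          measurable_comp_snd ((M.measurable_mech hF).comp
            (hqm v (T ∩ S) fun a ha => ⟨hT a ha, hcpa a ha⟩))
        refine ⟨_, hk, hker v S F hF _ (hk.mono (hle _) le_rfl) fun s C hC hCc => ?_⟩
        have hcongr : ∀ ν : Measure (∀ v, D v), ∫⁻ w in C, M.mech v (fun i => w i) F ∂ν =
            ∫⁻ w in C, M.mech v (q v w) F ∂ν := fun ν =>
          setLIntegral_congr_fun (coordSigma_le S C hC) fun w hw => by
            simp [hmech v S hpa' w (hCc w hw)]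
        obtain _ | _ := s
        · exact (M.law_localMarkov hS' hvS hpa' hF hC).trans (hcongr _)
        · exact (M.lawDo_localMarkov_of_ne π hS hvX hvS hpa' hF hC).trans (hcongr _)
      rcases hfam v hv hvX with ⟨hvR, hT⟩ | ⟨hvL, hT⟩
      · refine .inl ⟨hvR, ?_⟩
        rintro _ ⟨F, hF, rfl⟩
        obtain ⟨k, hk, hkC⟩ := hspec _ hT F hF
        exact ⟨k, hk.mono le_sup_right le_rfl, hkC⟩
      · refine .inr ⟨hvL, ?_⟩
        rintro _ ⟨F, hF, rfl⟩
        exact hspec _ hT F hF)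
  set T : Set (Bool × ∀ v, D v) := ⋂ v, {ω | ∀ a, c v = some a → ω.2 v = a} with hT
  have hTs : ∀ s, Prod.mk s ⁻¹' T = {w | c.Agrees w} := fun s => by
    ext w
    simp [hT, PartialAssignment.Agrees]
  have hTm : MeasurableSet T := MeasurableSet.iInter fun v =>
    ((measurable_pi_apply v).comp measurable_snd).comap_le _ (hctx v)
  have hsec : ∀ (C : Set (∀ v, D v)) (s : Bool), MeasurableSet C →
      (regimeMeasure ρ).restrict T (Prod.snd ⁻¹' C ∩ Prod.fst ⁻¹' {s}) =
        ρ s (C ∩ {w | c.Agrees w}) := by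
    intro C s hC
    have hm : MeasurableSet (Prod.snd ⁻¹' C ∩ Prod.fst ⁻¹' {s} : Set (Bool × ∀ v, D v)) :=
      (measurable_snd hC).inter (measurable_fst (measurableSet_singleton s))
    rw [Measure.restrict_apply hm, regimeMeasure_apply (hm.inter hTm), Finset.sum_eq_single s]
    · rw [Set.preimage_inter, hTs]
      congr 2
      ext w
      simp
    · intro t _ hts
      rw [Set.preimage_inter, Set.preimage_inter]
      have : Prod.mk t ⁻¹' (Prod.fst ⁻¹' {s} : Set (Bool × ∀ v, D v)) = ∅ := by
        ext w
        simpa using hts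
      simp [this]
    · simp
  have hBm := coordSigma_le _ B hB
  have hB' : MeasurableSet[regimeSigma D (R ∪ Z)] (Prod.snd ⁻¹' B) := by
    rw [regimeSigma_eq_comap]
    exact ⟨B, hB, rfl⟩
  -- `b` is a `Z`-measurable conditional probability of `B` common to both regimes. The mass of `B`
  -- in a regime is the integral of `b` over that slice, which depends only on the law on `Z`.
  obtain ⟨b, hb, hbA⟩ := hCI.symm (sup_le hle₀ (hle _)) (hle _)
    ((sigmaOf_mono Set.subset_union_right).trans le_sup_right)
    (sigmaOf_mono Set.subset_union_right) _ hB'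
  have hs : ∀ s, MeasurableSet[MeasurableSpace.comap (Prod.fst : Bool × (∀ v, D v) → Bool) ⊤]
      (Prod.fst ⁻¹' {s}) := fun s => ⟨{s}, trivial, rfl⟩
  have hval : ∀ s, ρ s (B ∩ {w | c.Agrees w}) =
      ∫⁻ ω in Set.univ, b ω ∂((regimeMeasure ρ).restrict T).restrict (Prod.fst ⁻¹' {s}) := by
    intro s
    rw [← hsec B s hBm, hbA _ (le_sup_left (a := MeasurableSpace.comap Prod.fst ⊤)
      (b := regimeSigma D (L ∪ Z)) _ (hs s)), Measure.restrict_univ]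
  refine (hval false).trans (Eq.trans ?_ (hval true).symm)
  refine setLIntegral_congr_measure_of_trim (hle Z) (fun A hA => ?_) MeasurableSet.univ hb
  rw [regimeSigma_eq_comap] at hA
  obtain ⟨A, hA, rfl⟩ := hA
  rw [Measure.restrict_apply' (hle₀ _ (hs _)), Measure.restrict_apply' (hle₀ _ (hs _)),
    hsec _ _ (coordSigma_le Z A hA), hsec _ _ (coordSigma_le Z A hA)]
  exact hZ A hA

end SCM

/-! ### Refining a context by one variable -/

namespace PartialAssignment

variable {V : Type uV} {D : V → Type uD}

theorem dom_update_subset [DecidableEq V] {c : PartialAssignment D} {W : V} {a : D W} {S : Set V}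
    (hc : c.dom ⊆ S) (hW : W ∈ S) : dom (Function.update c W (some a)) ⊆ S := by
  intro v hv
  by_cases h : v = W
  · exact h ▸ hW
  · exact hc fun hcv => hv ((Function.update_of_ne h _ _).trans hcv)

theorem agrees_update_iff [DecidableEq V] {c : PartialAssignment D} {W : V} (hW : W ∉ c.dom)
    {a : D W} {w : ∀ v, D v} :
    Agrees (Function.update c W (some a)) w ↔ c.Agrees w ∧ w W = a := by
  constructor
  · refine fun h => ⟨fun v b hv => ?_, h W a (Function.update_self _ _ _)⟩
    have hvW : v ≠ W := by
      rintro rfl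
      exact hW fun hcW => by simp [hcW] at hv
    exact h v b ((Function.update_of_ne hvW _ _).trans hv)
  · rintro ⟨h, rfl⟩ v b hv
    by_cases hvW : v = W
    · subst hvW
      have h' : Function.update c v (some (w v)) v = some (w v) := Function.update_self _ _ _
      exact Option.some_injective _ (h'.symm.trans hv)
    · exact h v b ((Function.update_of_ne hvW _ _).symm.trans hv)

end PartialAssignment

namespace MeasureTheory

theorem measure_inter_eq_tsum {Ω α : Type*} [MeasurableSpace Ω] [Countable α] (μ : Measure Ω)
    {A C : Set Ω} {Ca : α → Set Ω} (h : C = ⋃ a, Ca a) (hd : Pairwise (Function.onFun Disjoint Ca))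
    (hA : MeasurableSet A) (hC : ∀ a, MeasurableSet (Ca a)) : μ (A ∩ C) = ∑' a, μ (A ∩ Ca a) := by
  rw [h, Set.inter_iUnion]
  exact measure_iUnion (fun a b hab => (hd hab).mono Set.inter_subset_right Set.inter_subset_right)
    fun a => hA.inter (hC a)

end MeasureTheory

namespace DiGraph

theorem isAncestral_nondescendants {V : Type*} {E : V → V → Prop} (X : V) :
    IsAncestral E {v | ¬ Relation.ReflTransGen E X v} :=
  fun _ hb _ hab h => hb (h.tail hab)

end DiGraph

/-! ### Agreement of the two laws on a separator -/

namespace SCM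

open DiGraph

variable {V : Type uV} [Fintype V] [DecidableEq V] {D : V → Type uD} [∀ v, MeasurableSpace (D v)]
  {G : LDAG V D}

omit [DecidableEq V] in
theorem cond_obs (M : SCM.{uV, uD, uU} G) {O : Set V} {c : PartialAssignment D}
    (hc : ∀ v ∈ c.dom, MeasurableSingletonClass (D v)) (hO : c.dom ⊆ O) :
    cond (M.obs O) {o | c.AgreesOn o} = (cond M.law {w | c.Agrees w}).map O.domRestrict := by
  have hm : Measurable (O.domRestrict : (∀ v, D v) → ∀ v : O, D v) :=
    measurable_pi_iff.2 fun v => measurable_pi_apply _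
  have hpre : O.domRestrict ⁻¹' {o : ∀ v : O, D v | c.AgreesOn o} = {w | c.Agrees w} := by
    ext w
    refine ⟨fun h v a hv => h ⟨v, hO (by simp [PartialAssignment.dom, hv])⟩ a hv,
      fun h v a hv => h v a hv⟩
  have hC : MeasurableSet {o : ∀ v : O, D v | c.AgreesOn o} := by
    have : {o : ∀ v : O, D v | c.AgreesOn o} =
        ⋂ v : O, (fun o => o v) ⁻¹' {x : D v | ∀ a, c v = some a → x = a} := by
      ext
      simp [PartialAssignment.AgreesOn]
    rw [this]
    exact MeasurableSet.iInter fun v => measurable_pi_apply v (c.measurableSet_agrees_at hc v)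
  rw [ProbabilityTheory.cond, ProbabilityTheory.cond, obs, Measure.restrict_map hm hC,
    Measure.map_apply hm hC, hpre, Measure.map_smul]

variable {X : V} {P : Set V}

/-- Context variables are non-descendants of the action, so conditioning on the context has the same
normalizing constant in both regimes. -/
theorem lawDo_agrees (M : SCM.{uV, uD, uU} G) (hP : ∀ v ∈ P, ¬ Relation.ReflTransGen G.edge X v)
    (π : Kernel (∀ v : P, D v) (D X)) [IsMarkovKernel π] {c : PartialAssignment D}
    (hc : ∀ v ∈ c.dom, MeasurableSingletonClass (D v)) (hcP : c.dom ⊆ P) :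
    M.lawDo X P π {w | c.Agrees w} = M.law {w | c.Agrees w} :=
  M.lawDo_eq_law π (isAncestral_nondescendants X) (fun h => h .refl)
    (c.measurableSet_agrees hc (hcP.trans hP))

/-- The action keeps its joint law with `Z` when it is drawn from its conditional law given `Z`. -/
theorem law_eq_lawDo_of_condKernel (M : SCM.{uV, uD, uU} G)
    (hP : ∀ v ∈ P, ¬ Relation.ReflTransGen G.edge X v) (π : Kernel (∀ v : P, D v) (D X))
    [IsMarkovKernel π] {c : PartialAssignment D}
    (hc : ∀ v ∈ c.dom, MeasurableSingletonClass (D v)) {Z : Set V} (hcZ : c.dom ⊆ Z) (hZP : Z ⊆ P)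
    (κ : Kernel (∀ v : Z, D v) (D X)) [IsMarkovKernel κ]
    (hκ : (cond M.law {w | c.Agrees w}).map (fun w => (Z.domRestrict w, w X)) =
      ((cond M.law {w | c.Agrees w}).map Z.domRestrict).compProd κ)
    (hπ : ∀ p, π p = κ (Set.domRestrict₂ hZP p)) {A : Set (∀ v, D v)}
    (hA : MeasurableSet[coordSigma D (Z ∪ {X})] A) :
    M.law (A ∩ {w | c.Agrees w}) = M.lawDo X P π (A ∩ {w | c.Agrees w}) := by
  have hCZ := c.measurableSet_agrees hc hcZ
  have hC := coordSigma_le _ _ hCZ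
  have hAm := coordSigma_le _ _ hA
  -- In a null context `cond` is the zero measure and `hκ` carries no information, but both masses
  -- vanish.
  by_cases h0 : M.law {w | c.Agrees w} = 0
  · rw [measure_mono_null Set.inter_subset_right h0, measure_mono_null Set.inter_subset_right
      ((M.lawDo_agrees hP π hc (hcZ.trans hZP)).trans h0)]
  rw [← Measure.restrict_apply hAm, ← Measure.restrict_apply hAm]
  rw [coordSigma, sigmaOf_union] at hA
  refine measure_eq_of_sup (coordSigma_le Z) (coordSigma_le {X}) (fun A E hA hE => ?_) hA
  obtain ⟨F, hF, rfl⟩ : ∃ F : Set (D X), MeasurableSet F ∧ (fun w => w X) ⁻¹' F = E := by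
    have e : coordSigma D {X} = MeasurableSpace.comap (fun w => w X) inferInstance := by
      simp only [coordSigma, sigmaOf, Set.mem_singleton_iff, iSup_iSup_eq_left]
    rw [e] at hE
    exact hE
  have hE := coordSigma_le _ _ hE
  have hA' := coordSigma_le _ _ hA
  obtain ⟨A', hAm', rfl⟩ := coordSigma_le_comap Z A hA
  set C := {w : ∀ v, D v | c.Agrees w}
  set A := Z.domRestrict ⁻¹' A'
  have hZm : Measurable (Z.domRestrict : (∀ v, D v) → ∀ v : Z, D v) :=
    measurable_pi_iff.2 fun v => measurable_pi_apply _
  have hlaw : M.law (A ∩ (fun w => w X) ⁻¹' F ∩ C) =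
      ∫⁻ w in A ∩ C, κ (Z.domRestrict w) F ∂M.law := by
    have := DFunLike.congr_fun hκ (A' ×ˢ F)
    rw [Measure.map_apply (hZm.prodMk (measurable_pi_apply X)) (hAm'.prod hF),
      Set.mk_preimage_prod,
      Measure.compProd_apply_prod hAm' hF,
      setLIntegral_map hAm' (Kernel.measurable_coe κ hF) hZm, ProbabilityTheory.cond,
      Measure.smul_apply, Measure.restrict_smul, lintegral_smul_measure,
      Measure.restrict_restrict hA', Measure.restrict_apply (hA'.inter hE)] at this
    rwa [smul_eq_mul, smul_eq_mul, ENNReal.mul_right_inj (by simp) (by simpa using h0)] at this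
  have hS := isAncestral_nondescendants (E := G.edge) X
  have hXS : X ∉ {v | ¬ Relation.ReflTransGen G.edge X v} := fun h => h .refl
  have hAC : MeasurableSet[coordSigma D {v | ¬ Relation.ReflTransGen G.edge X v}] (A ∩ C) :=
    sigmaOf_mono (hZP.trans hP) _ (MeasurableSet.inter hA hCZ)
  rw [Measure.restrict_apply (hA'.inter hE), Measure.restrict_apply (hA'.inter hE), hlaw,
    show A ∩ (fun w => w X) ⁻¹' F ∩ C = {w | w X ∈ F} ∩ (A ∩ C) by
      ext; simp only [Set.mem_inter_iff, Set.mem_preimage, Set.mem_ofPred_eq]; tauto,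
    M.lawDo_localMarkov_self π hS hXS hP hF hAC]
  simp only [hπ]
  exact (setLIntegral_congr_measure_of_trim (coordSigma_le _)
    (fun B hB => M.lawDo_eq_law π hS hXS hB) hAC ((Kernel.measurable_coe κ hF).comp
      (measurable_coord_domRestrict (hZP.trans hP)))).symm

/-- Laws that agree on `T \ C` given the context agree on `T` in the context. -/
theorem law_eq_lawDo_of_surrogate (M : SCM.{uV, uD, uU} G)
    (hP : ∀ v ∈ P, ¬ Relation.ReflTransGen G.edge X v) (π : Kernel (∀ v : P, D v) (D X))
    [IsMarkovKernel π] {c : PartialAssignment D}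
    (hc : ∀ v ∈ c.dom, MeasurableSingletonClass (D v)) (hcP : c.dom ⊆ P) {T : Set V}
    (h : (cond (M.lawDo X P π) {w | c.Agrees w}).map (T \ c.dom).domRestrict =
      (cond M.law {w | c.Agrees w}).map (T \ c.dom).domRestrict) {A : Set (∀ v, D v)}
    (hA : MeasurableSet[coordSigma D T] A) :
    M.law (A ∩ {w | c.Agrees w}) = M.lawDo X P π (A ∩ {w | c.Agrees w}) := by
  classical
  have hCm := coordSigma_le _ _ (c.measurableSet_agrees hc hcP)
  have hAm := coordSigma_le _ _ hA
  have hC := M.lawDo_agrees hP π hc hcP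
  by_cases h0 : M.law {w | c.Agrees w} = 0
  · rw [measure_mono_null Set.inter_subset_right h0,
      measure_mono_null Set.inter_subset_right (hC.trans h0)]
  obtain ⟨r, hr⟩ : ∃ r, c.Agrees r := nonempty_of_measure_ne_zero h0
  -- `j` completes an assignment of `T \ C` by the context values of `r`. On the context event, `A`
  -- can then be tested on the coordinates in `T \ C` alone.
  set j : (∀ v : (T \ c.dom : Set V), D v) → ∀ v, D v :=
    fun p v => if hv : v ∈ T \ c.dom then p ⟨v, hv⟩ else r v with hj
  have hjm : Measurable j := by
    refine measurable_pi_iff.2 fun v => ?_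
    by_cases hv : v ∈ T \ c.dom
    · simpa only [hj, hv, dite_true] using measurable_pi_apply _
    · simp only [hj, hv, dite_false]
      exact measurable_const
  have hTm : Measurable ((T \ c.dom).domRestrict : (∀ v, D v) → _) :=
    measurable_pi_iff.2 fun v => measurable_pi_apply _
  have hAC : A ∩ {w | c.Agrees w} =
      (T \ c.dom).domRestrict ⁻¹' (j ⁻¹' A) ∩ {w | c.Agrees w} := by
    ext w
    refine and_congr_left fun hw => mem_iff_of_coordSigma hA fun v hv => ?_
    by_cases hvc : v ∈ c.dom
    · obtain ⟨a, ha⟩ := Option.ne_none_iff_exists'.1 hvc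
      simp [hj, hvc, hw v a ha, hr v a ha]
    · simp [hj, hvc, hv]
  have := DFunLike.congr_fun h (j ⁻¹' A)
  rw [Measure.map_apply hTm (hjm hAm), Measure.map_apply hTm (hjm hAm), ProbabilityTheory.cond,
    ProbabilityTheory.cond, hC, Measure.smul_apply, Measure.smul_apply, Measure.restrict_apply (hTm (hjm hAm)),
    Measure.restrict_apply (hTm (hjm hAm)), ← hAC, smul_eq_mul, smul_eq_mul,
    ENNReal.mul_right_inj (by simp) (by simpa using h0)] at this
  exact this.symm

/-- Only the policy at the value of an input counts on the event that the input has that value. -/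
theorem lawDo_congr_of_eq (M : SCM.{uV, uD, uU} G)
    (hP : ∀ v ∈ P, ¬ Relation.ReflTransGen G.edge X v) (π π' : Kernel (∀ v : P, D v) (D X))
    [IsMarkovKernel π] [IsMarkovKernel π'] {W : V} (hW : W ∈ P) {a : D W}
    (h : ∀ p, p ⟨W, hW⟩ = a → π p = π' p) {A : Set (∀ v, D v)} (hA : MeasurableSet A)
    (hAa : ∀ w ∈ A, w W = a) : M.lawDo X P π A = M.lawDo X P π' A := by
  rw [M.lawDo_apply π hA, M.lawDo_apply π' hA]
  refine lintegral_congr fun u => ?_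
  by_cases hu : M.sol u W = a
  · rw [h (P.domRestrict (M.sol u)) hu]
  · have : {x | M.solDo X x u ∈ A} = ∅ := by
      refine Set.eq_empty_of_forall_notMem fun x hx => hu ?_
      rw [← hAa _ hx]
      exact (M.solDo_eq_sol (isAncestral_nondescendants X) (fun h => h .refl) x u (hP W hW)).symm
    simp [this]

end SCM

/-! ### Soundness of the algorithm -/

namespace LDAG

variable {V : Type uV} {D : V → Type uD}

theorem acyclic_contextDAG (G : LDAG V D) (c : PartialAssignment D) (v : V) :
    ¬ Relation.TransGen (G.contextDAG c) v v :=
  fun h => G.acyclic v (Relation.TransGen.mono (fun _ _ => And.left) _ _ h)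

end LDAG

namespace ImitationProblem

open DiGraph

variable {V : Type uV} [Fintype V] [DecidableEq V] {D : V → Type uD} [∀ v, MeasurableSpace (D v)]

theorem SubImitate.isMarkovKernel {I : ImitationProblem V D} {PO : Measure (∀ v : I.O, D v)}
    {c : PartialAssignment D} {π : I.PrePolicy} (h : SubImitate.{uV, uD, uU} I PO c π) :
    IsMarkovKernel π := by
  cases h <;> assumption

variable (I : ImitationProblem V D)

omit [Fintype V] [DecidableEq V] [∀ v, MeasurableSpace (D v)] in
theorem X_notMem_P : I.X ∉ I.P := fun h => I.P_nondesc _ h .refl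

omit [Fintype V] [DecidableEq V] [∀ v, MeasurableSpace (D v)] in
theorem dom_subset_sepSet {c : PartialAssignment D} (hc : c.dom ⊆ I.P) : c.dom ⊆ I.sepSet c :=
  fun v hv => ⟨hc hv, v, .inr (.inr hv), .refl⟩

/-- The edges out of `X` that are missing in the tested graph come back by adding `X` to the
separator: with `Z_c ∪ {X}` in place of `Z_c`, the partition also fits the full context-specific
DAG. -/
theorem law_eq_lawDo_of_findSep (M : SCM.{uV, uD, uU} I.G) {c : PartialAssignment D}
    (hc : ∀ v ∈ c.dom, MeasurableSingletonClass (D v)) (hcP : c.dom ⊆ I.P) (π : I.PrePolicy)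
    [IsMarkovKernel π] (hsep : I.FindSep c)
    (hcond : I.IsCondPolicy (M.obs I.O) c (I.sepSet c) (I.sepSet_subset c) π)
    {F : Set (D I.Y)} (hF : MeasurableSet F) :
    M.law ({w | w I.Y ∈ F} ∩ {w | c.Agrees w}) =
      M.lawDo I.X I.P π ({w | w I.Y ∈ F} ∩ {w | c.Agrees w}) := by
  obtain ⟨κ, hκm, hκ, hπ⟩ := hcond
  have hcZ := I.dom_subset_sepSet hcP
  have hZP := I.sepSet_subset c
  have hY : I.Y ∉ I.sepSet c := fun h => I.Y_latent (I.P_subset (hZP h))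
  have hacyc := I.G.acyclic_contextDAG c
  obtain ⟨L, R, hXL, hYR, -, -, hLR, hfam⟩ := DSep.exists_partition
    (fun v h => hacyc v (Relation.TransGen.mono (fun _ _ => And.left) _ _ h)) hsep
    (fun h => I.X_notMem_P (hZP h)) hY
  have hmR : Measurable (I.O.domRestrict : (∀ v, D v) → ∀ v : I.O, D v) :=
    measurable_pi_iff.2 fun v => measurable_pi_apply _
  have hm₂ : Measurable (Set.domRestrict₂ (hZP.trans I.P_subset) :
      (∀ v : I.O, D v) → ∀ v : I.sepSet c, D v) :=
    measurable_pi_iff.2 fun v => measurable_pi_apply _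
  rw [M.cond_obs hc (hcP.trans I.P_subset),
    Measure.map_map (hm₂.prodMk (measurable_pi_apply _)) hmR,
    Measure.map_map hm₂ hmR] at hκ
  refine M.law_eq_lawDo_of_partition I.P_nondesc π hc (L := L) (Z := I.sepSet c ∪ {I.X}) (R := R)
    (hcZ.trans Set.subset_union_left) (hLR _ hXL) (fun v hv hvX => ?_) (fun a ha => ?_)
    (fun F hF => ?_) (fun A hA => M.law_eq_lawDo_of_condKernel I.P_nondesc π hc hcZ hZP κ hκ hπ hA)
    (measurable_coord (S := R ∪ (I.sepSet c ∪ {I.X})) (Or.inl hYR) hF)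
  · have hv' : v ∈ L ∪ I.sepSet c ∪ R := by
      simp only [Set.mem_union, Set.mem_singleton_iff] at hv ⊢
      tauto
    have hcases : ∀ T : Set V, (∀ a, removeOut (I.G.contextDAG c) I.X a v → a ∈ T ∪ I.sepSet c) →
        ∀ a, I.G.contextDAG c a v → a ∈ T ∪ (I.sepSet c ∪ {I.X}) := by
      intro T hT a ha
      by_cases haX : a = I.X
      · exact .inr (.inr haX)
      · exact (hT a ⟨ha, haX⟩).imp_right .inl
    exact (hfam v hv').imp (And.imp_right (hcases L)) (And.imp_right (hcases R))
  · have haX : a ≠ I.X := by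
      rintro rfl
      exact hacyc _ (.single ha)
    rcases hfam I.X (.inl (.inl hXL)) with h | h
    · exact (h.2 a ⟨ha, haX⟩).imp_right .inl
    · exact absurd hXL h.1
  · simp only [hπ]
    exact (Kernel.measurable_coe κ hF).comp
      (measurable_coord_domRestrict fun v hv => ⟨.inr (.inl hv), hZP hv⟩)

/-- In the graph with policy edges the inputs `P` are parents of `X`, so the partition places them
in `L ∪ T`. Thus both mechanisms of the action, natural and policy, stay on the side of `L`. -/
theorem law_eq_lawDo_of_isMinSep (M : SCM.{uV, uD, uU} I.G) {c : PartialAssignment D}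
    (hc : ∀ v ∈ c.dom, MeasurableSingletonClass (D v)) (hcP : c.dom ⊆ I.P) (π : I.PrePolicy)
    [IsMarkovKernel π] {T : Set V} (hT : I.IsMinSep c T)
    (h : (cond (M.lawDo I.X I.P π) {w | c.Agrees w}).map (T \ c.dom).domRestrict =
      (cond M.law {w | c.Agrees w}).map (T \ c.dom).domRestrict)
    {F : Set (D I.Y)} (hF : MeasurableSet F) :
    M.law ({w | w I.Y ∈ F} ∩ {w | c.Agrees w}) =
      M.lawDo I.X I.P π ({w | w I.Y ∈ F} ∩ {w | c.Agrees w}) := by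
  obtain ⟨hcT, hTO, hsep⟩ := hT.prop
  have hacyc := acyclic_addParents (I.G.acyclic_contextDAG c)
    (fun v hv h => I.P_nondesc v hv (Relation.ReflTransGen.mono (fun _ _ => And.left) _ _ h))
  obtain ⟨L, R, hXL, hYR, -, -, hLR, hfam⟩ := DSep.exists_partition hacyc hsep
    (fun h => (hTO h).2 rfl) (fun h => I.Y_latent (hTO h).1)
  have hX : ∀ a, addParents (I.G.contextDAG c) I.P I.X a I.X → a ∈ L ∪ T := by
    rcases hfam I.X (.inl (.inl hXL)) with h | h
    · exact h.2
    · exact absurd hXL h.1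
  exact M.law_eq_lawDo_of_partition I.P_nondesc π hc hcT (hLR _ hXL)
    (fun v hv _ => (hfam v hv).imp (And.imp_right fun h a ha => h a (.inl ha))
      (And.imp_right fun h a ha => h a (.inl ha))) (fun a ha => hX a (.inl ha))
    (fun F hF => (Kernel.measurable_coe π hF).comp
      (measurable_coord_domRestrict fun v hv => ⟨hX v (.inr ⟨hv, rfl⟩), hv⟩))
    (fun A hA => M.law_eq_lawDo_of_surrogate I.P_nondesc π hc hcP h hA)
    (measurable_coord (S := R ∪ T) (Or.inl hYR) hF)

/-- Induction on the run; every variable added to the context is a context variable in `P`, so both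
inclusions persist. -/
theorem SubImitate.law_eq_lawDo
    (hdiscrete : ∀ v ∈ I.G.contextVars, Countable (D v) ∧ MeasurableSingletonClass (D v))
    {PO : Measure (∀ v : I.O, D v)} {c : PartialAssignment D} {π : I.PrePolicy}
    (h : SubImitate.{uV, uD, uU} I PO c π) (hcP : c.dom ⊆ I.P) (hcL : c.dom ⊆ I.G.contextVars)
    (M : SCM.{uV, uD, uU} I.G) (hM : M.obs I.O = PO) {F : Set (D I.Y)} (hF : MeasurableSet F) :
    M.law ({w | w I.Y ∈ F} ∩ {w | c.Agrees w}) =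
      M.lawDo I.X I.P π ({w | w I.Y ∈ F} ∩ {w | c.Agrees w}) := by
  induction h with
  | sep c π hπ hsep hcond =>
    subst hM
    exact I.law_eq_lawDo_of_findSep M (fun v hv => (hdiscrete v (hcL hv)).2) hcP π hsep hcond hF
  | surrogate c π hπ _ T hT hTO q hid hsolve =>
    subst hM
    have hc : ∀ v ∈ c.dom, MeasurableSingletonClass (D v) := fun v hv => (hdiscrete v (hcL hv)).2
    refine I.law_eq_lawDo_of_isMinSep M hc hcP π hT ?_ hF
    rw [hid M rfl, hsolve, M.cond_obs hc (hcP.trans I.P_subset), Measure.map_map]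
    · rfl
    · exact measurable_pi_iff.2 fun v => measurable_pi_apply _
    · exact measurable_pi_iff.2 fun v => measurable_pi_apply _
  | branch c π hπ _ W hW hWP hWc πs hrec hglue ih =>
    have hWd := hdiscrete W hW
    have := hWd.1
    have hdom : ∀ a : D W, PartialAssignment.dom (Function.update c W (some a)) ⊆ I.G.contextVars :=
      fun a => PartialAssignment.dom_update_subset hcL hW
    have hCm : ∀ a : D W, MeasurableSet
        {w | PartialAssignment.Agrees (Function.update c W (some a)) w} := fun a =>
      coordSigma_le _ _ (PartialAssignment.measurableSet_agrees _
        (fun v hv => (hdiscrete v (hdom a hv)).2) subset_rfl)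
    have hFm : MeasurableSet {w : ∀ v, D v | w I.Y ∈ F} := measurable_pi_apply I.Y hF
    have hU : {w | c.Agrees w} =
        ⋃ a : D W, {w | PartialAssignment.Agrees (Function.update c W (some a)) w} := by
      ext w
      simp [PartialAssignment.agrees_update_iff hWc]
    have hd : Pairwise (Function.onFun Disjoint fun a : D W =>
        {w | PartialAssignment.Agrees (Function.update c W (some a)) w}) := by
      intro a b hab
      refine Set.disjoint_left.2 fun w ha hb => hab ?_
      rw [← ((PartialAssignment.agrees_update_iff hWc).1 ha).2,
        ← ((PartialAssignment.agrees_update_iff hWc).1 hb).2]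
    -- The context splits into countably many disjoint contexts, one for each value of `W`, and the
    -- masses are compared term by term.
    rw [measure_inter_eq_tsum _ hU hd hFm hCm, measure_inter_eq_tsum _ hU hd hFm hCm]
    refine tsum_congr fun a => ?_
    have := (hrec a).isMarkovKernel
    rw [ih a (PartialAssignment.dom_update_subset hcP hWP) (hdom a)]
    refine M.lawDo_congr_of_eq I.P_nondesc (πs a) π hWP (a := a) (fun p hp => ?_)
      (hFm.inter (hCm a)) fun w hw => ((PartialAssignment.agrees_update_iff hWc).1 hw.2).2
    rw [hglue p, hp]

end ImitationProblem

theorem mainTheorem7 {V : Type uV} [Fintype V] [DecidableEq V] {D : V → Type uD}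
    [∀ v, MeasurableSpace (D v)] (I : ImitationProblem V D)
    (hdiscrete : ∀ v ∈ I.G.contextVars, Countable (D v) ∧ MeasurableSingletonClass (D v))
    (PO : Measure (∀ v : I.O, D v)) (π : I.PrePolicy)
    (hret : ImitationProblem.Imitate2.{uV, uD, uU} I PO π) :
    ImitationProblem.IsImitatingPolicy.{uV, uD, uU} I PO π := by
  have hπ : IsMarkovKernel π := ImitationProblem.SubImitate.isMarkovKernel hret
  refine ⟨hπ, fun M hM => Measure.ext fun F hF => ?_⟩
  have hFm : MeasurableSet {w : ∀ v, D v | w I.Y ∈ F} := measurable_pi_apply I.Y hF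
  have hC : {w : ∀ v, D v | PartialAssignment.empty.Agrees w} = Set.univ :=
    Set.eq_univ_of_forall fun w v a h => by simp [PartialAssignment.empty] at h
  have h := ImitationProblem.SubImitate.law_eq_lawDo I hdiscrete hret
    (fun v hv => absurd rfl hv) (fun v hv => absurd rfl hv) M hM hF
  rw [hC, Set.inter_univ] at h
  rw [Measure.map_apply (measurable_pi_apply _) hF, Measure.map_apply (measurable_pi_apply _) hF]
  exact h.symm
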